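/- **Setting.** Let $(X,\mu)$ be an atom-free standard probability space with a fixed isomorphism mod $0$ $\sigma_X:[0,1]\to X$ (bijective, measurable and measure-preserving in both directions, outside null sets). A *graphon* on $X$ is a measurable function $w:X\times X\to[0,1]$ with $w(x,y)=w(y,x)$ almost everywhere. Its integral operator is $T_w:L^2(X)\to L^2(X)$, $(T_w\xi)(x)=\int_X w(x,y)\xi(y)\,d\mu(y)$. The cut norm is $\|u\|_\Box=\sup_{S,T}\left|\int_{S\times T}u\right|$, the supremum being over measurable $S,T\subseteq X$. For $f\in L^2(X)$ (complex-valued) and an eigenvalue $\nu$ of $T_w$, $\widehat f(\nu)\in L^2(X)$ denotes the orthogonal projection of $f$ onto the $\nu$-eigenspace of $T_w$. For a self-adjoint compact operator $T$ list the nonzero eigenvalues with multiplicity as $\lambda_1(T)\ge\lambda_2(T)\ge\dots\ge 0\ge\dots\ge\lambda_{-2}(T)\ge\lambda_{-1}(T)$, the positive and the negative part each padded with zeros if it is finite. Let $G$ be a simple graph with vertices labeled $1,\dots,N$, put $I_k=[\frac{k-1}N,\frac kN)$, and let $A=\frac1N\,\mathrm{Adj}(G)$ be its adjacency matrix divided by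 the number of vertices. The graphon $w_{G,X}$ equals $1$ at $(x,y)$ if $\sigma_X^{-1}(x)\in I_i$, $\sigma_X^{-1}(y)\in I_j$ for adjacent $i,j$, and $0$ otherwise. For a graph signal $g\in\mathbb C^N$, $g^X\in L^2(X)$ is the function with value $\sqrt N\,g(k)$ on $\sigma_X(I_k)$, and for $\phi\in\mathbb C^N$ put $\widehat g(\phi)=\langle g,\phi\rangle=\sum_{k=1}^N g(k)\overline{\phi(k)}$. **Statement.** Let $(w,f)$ be a graphon signal on $X$ (a graphon $w$ and $f\in L^2(X)$), and let $(G_n,f_n)$ be graph signals on labeled graphs $G_n$ with $N_n$ vertices, labeled so that $\|w_{G_n,X}-w\|_\Box\to0$ and $\|f_n^X-f\|_2\to0$. Let $A_n=\frac1{N_n}\mathrm{Adj}(G_n)$, let $\lambda_i^n=\lambda_i(A_n)$ $(i\in\mathbb Z\setminus\{0\})$, and let $\phi_i^n\in\mathbb C^{N_n}$, for the indices $i$ with $\lambda^n_i\ne0$, be orthonormal with $A_n\phi_i^n=\lambda_i^n\phi_i^n$ (for the other indices $\phi_i^n$ may be any vector). Let $h(x)=\sum_{k=0}^m h_kx^k$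 be a polynomial with complex coefficients and let $H_n=h(A_n)=\sum_{k=0}^m h_kA_n^k$. Then for each nonzero eigenvalue $\nu$ of $T_w$ the index set $I_\nu=\{i\in\mathbb Z\setminus\{0\}:\lambda_i(T_w)=\nu\}$ is finite and $$\sum_{i\in I_\nu}\widehat{H_nf_n}(\phi_i^n)\,(\phi_i^n)^X\longrightarrow h(\nu)\,\widehat f(\nu)\quad\text{in }L^2(X)\text{ as }n\to\infty .$$ -/

import Mathlib

open MeasureTheory Filter Topology

noncomputable section

/-! ### Graphons and their integral operators -/

/-- A graphon represented on the probability space `(X, μ)`: a measurable function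
`X × X → [0,1]` that is symmetric almost everywhere. Measurability is understood with respect to
the completed product measure. -/
structure Graphon {X : Type*} [MeasurableSpace X] (μ : Measure X) where
  toFun : X → X → ℝ
  aemeasurable' : AEMeasurable (Function.uncurry toFun) (μ.prod μ)
  mem_Icc' : ∀ x y, toFun x y ∈ Set.Icc (0 : ℝ) 1
  symm' : ∀ᵐ p ∂(μ.prod μ), toFun p.1 p.2 = toFun p.2 p.1

/-- The cut norm of a kernel: the supremum over measurable `S, T` of `|∫_{S × T} u|`. -/
def cutNorm {X : Type*} [MeasurableSpace X] (μ : Measure X) (u : X → X → ℝ) : ℝ :=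
  ⨆ ST : {S : Set X // MeasurableSet S} × {T : Set X // MeasurableSet T},
    |∫ p in (ST.1 : Set X) ×ˢ (ST.2 : Set X), u p.1 p.2 ∂(μ.prod μ)|

section Operator

variable {X : Type*} [MeasurableSpace X] {μ : Measure X} [IsProbabilityMeasure μ]

theorem Graphon.integrable_mul (w : Graphon μ) (ξ : Lp ℂ 2 μ) :
    ∀ᵐ x ∂μ, Integrable (fun y => (w.toFun x y : ℂ) * ξ y) μ := by
  have hξ : Integrable (fun y => ξ y) μ := (Lp.memLp ξ).integrable (by norm_num)
  have hw : AEStronglyMeasurable (fun p : X × X => ((w.toFun p.1 p.2 : ℝ) : ℂ)) (μ.prod μ) :=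
    (Complex.measurable_ofReal.comp_aemeasurable w.aemeasurable').aestronglyMeasurable
  filter_upwards [hw.prodMk_left] with x hx
  refine hξ.bdd_mul (c := 1) hx (Eventually.of_forall fun y => ?_)
  have := w.mem_Icc' x y
  simp only [Complex.norm_real, Real.norm_eq_abs]
  exact abs_le.2 ⟨by linarith [this.1], this.2⟩

theorem Graphon.norm_integral_le (w : Graphon μ) (ξ : Lp ℂ 2 μ) (x : X) :
    ‖∫ y, (w.toFun x y : ℂ) * ξ y ∂μ‖ ≤ ‖ξ‖ := by
  have hξ : Integrable (fun y => ξ y) μ := (Lp.memLp ξ).integrable (by norm_num)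
  have h1 : ‖∫ y, (w.toFun x y : ℂ) * ξ y ∂μ‖ ≤ ∫ y, ‖ξ y‖ ∂μ := by
    refine norm_integral_le_of_norm_le hξ.norm (Eventually.of_forall fun y => ?_)
    have := w.mem_Icc' x y
    rw [norm_mul, Complex.norm_real, Real.norm_eq_abs, abs_of_nonneg this.1]
    exact mul_le_of_le_one_left (norm_nonneg _) this.2
  refine h1.trans ?_
  rw [integral_norm_eq_lintegral_enorm hξ.1, Lp.norm_def, ← eLpNorm_one_eq_lintegral_enorm]
  exact ENNReal.toReal_mono (Lp.eLpNorm_ne_top ξ)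
    (eLpNorm_le_eLpNorm_of_exponent_le (by norm_num) (Lp.aestronglyMeasurable ξ))

theorem Graphon.memLp_integral (w : Graphon μ) (ξ : Lp ℂ 2 μ) :
    MemLp (fun x => ∫ y, (w.toFun x y : ℂ) * ξ y ∂μ) 2 μ := by
  have hw : AEStronglyMeasurable (fun p : X × X => ((w.toFun p.1 p.2 : ℝ) : ℂ)) (μ.prod μ) :=
    (Complex.measurable_ofReal.comp_aemeasurable w.aemeasurable').aestronglyMeasurable
  have hm : AEStronglyMeasurable (fun p : X × X => (w.toFun p.1 p.2 : ℂ) * ξ p.2) (μ.prod μ) :=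
    hw.mul (Lp.aestronglyMeasurable ξ).comp_snd
  exact MemLp.of_bound hm.integral_prod_right' ‖ξ‖
    (Eventually.of_forall fun x => w.norm_integral_le ξ x)

/-- The integral operator `T_w` on `L²(X)`, `(T_w ξ)(x) = ∫ w(x, y) ξ(y) dμ(y)`. -/
def Graphon.op (w : Graphon μ) : Lp ℂ 2 μ →L[ℂ] Lp ℂ 2 μ :=
  LinearMap.mkContinuous
    { toFun := fun ξ => (w.memLp_integral ξ).toLp
      map_add' := fun ξ η => by
        rw [← MemLp.toLp_add]
        refine MemLp.toLp_congr _ _ ?_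
        filter_upwards [w.integrable_mul ξ, w.integrable_mul η] with x hx hy
        rw [Pi.add_apply, ← integral_add hx hy]
        refine integral_congr_ae ?_
        filter_upwards [Lp.coeFn_add ξ η] with y h
        rw [h, Pi.add_apply, mul_add]
      map_smul' := fun c ξ => by
        rw [RingHom.id_apply, ← MemLp.toLp_const_smul]
        refine MemLp.toLp_congr _ _ (Eventually.of_forall fun x => ?_)
        rw [Pi.smul_apply, smul_eq_mul, ← integral_const_mul]
        refine integral_congr_ae ?_
        filter_upwards [Lp.coeFn_smul c ξ] with y h
        rw [h, Pi.smul_apply, smul_eq_mul]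
        ring }
    1 (fun ξ => by
      rw [one_mul]
      have h := Lp.norm_le_of_ae_bound (f := (w.memLp_integral ξ).toLp) (norm_nonneg ξ)
        (by filter_upwards [(w.memLp_integral ξ).coeFn_toLp] with x hx
            rw [hx]; exact w.norm_integral_le ξ x)
      simpa [measureUnivNNReal] using h)

end Operator

/-! ### Spectra: eigenvalues with multiplicity, in the order `λ₁ ≥ λ₂ ≥ … ≥ 0 ≥ … ≥ λ₋₂ ≥ λ₋₁` -/

section Spectrum

variable {E : Type*} [AddCommGroup E] [Module ℂ E]

/-- The `k`-th largest positive eigenvalue of `T`, counted with multiplicity, for `k ≥ 1`; it is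
`0` if there are fewer than `k`. (It is the largest `t > 0` such that the eigenspaces for the
eigenvalues `≥ t` span a space of dimension at least `k`.) -/
def posEigenvalue (T : Module.End ℂ E) (k : ℕ) : ℝ :=
  sSup {t : ℝ | 0 < t ∧
    (k : Cardinal) ≤ Module.rank ℂ ↥(⨆ s ∈ Set.Ici t, T.eigenspace ((s : ℝ) : ℂ))}

/-- The eigenvalues `λ_i`, `i ∈ ℤ \ {0}`: for `i > 0` the `i`-th largest positive eigenvalue, for
`i < 0` the `|i|`-th smallest negative eigenvalue, with multiplicity and padded with zeros.
The value at `i = 0` is not used. -/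
def orderedEigenvalue (T : Module.End ℂ E) (i : ℤ) : ℝ :=
  if 0 < i then posEigenvalue T i.natAbs
  else if i < 0 then -posEigenvalue (-T) i.natAbs
  else 0

/-- The set `I_ν` of the indices `i` with `λ_i = ν`. -/
def eigenvalueIndices (T : Module.End ℂ E) (ν : ℝ) : Set ℤ :=
  {i : ℤ | i ≠ 0 ∧ orderedEigenvalue T i = ν}

end Spectrum

/-- `φ` is an orthonormal system of eigenvectors of `T` for the nonzero eigenvalues `λ_i` of `T`
in the above order. (Nothing is required of `φ i` if `λ_i` is one of the padding zeros.) -/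
def IsOrderedEigenvectors {E : Type*} [NormedAddCommGroup E] [InnerProductSpace ℂ E]
    (T : Module.End ℂ E) (φ : ℤ → E) : Prop :=
  Orthonormal ℂ (fun i : {i : ℤ // i ≠ 0 ∧ orderedEigenvalue T i ≠ 0} => φ i) ∧
    ∀ i : ℤ, i ≠ 0 → orderedEigenvalue T i ≠ 0 →
      T (φ i) = ((orderedEigenvalue T i : ℝ) : ℂ) • φ i

section Fourier

variable {X : Type*} [MeasurableSpace X] {μ : Measure X} [IsProbabilityMeasure μ]

/-- The eigenspace of `T_w`. -/
def Graphon.eigenspace (w : Graphon μ) (ν : ℝ) : Submodule ℂ (Lp ℂ 2 μ) :=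
  Module.End.eigenspace (w.op : Module.End ℂ (Lp ℂ 2 μ)) (ν : ℂ)

instance Graphon.completeSpace_eigenspace (w : Graphon μ) (ν : ℝ) :
    CompleteSpace (w.eigenspace ν) := by
  have h : w.eigenspace ν
      = LinearMap.ker (w.op - (ν : ℂ) • ContinuousLinearMap.id ℂ (Lp ℂ 2 μ)).toLinearMap := by
    ext ξ
    rw [Graphon.eigenspace, Module.End.mem_eigenspace_iff, LinearMap.mem_ker]
    exact sub_eq_zero.symm
  have hc : IsClosed (w.eigenspace ν : Set (Lp ℂ 2 μ)) := by
    rw [h]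
    exact ContinuousLinearMap.isClosed_ker _
  exact hc.completeSpace_coe

/-- The graphon Fourier transform of the signal `f` on `w` at the eigenvalue `ν`: the orthogonal
projection of `f` onto the `ν`-eigenspace of `T_w`. -/
def Graphon.fourier (w : Graphon μ) (f : Lp ℂ 2 μ) (ν : ℝ) : Lp ℂ 2 μ :=
  (w.eigenspace ν).starProjection f

/-- Convergence in norm of graphon signals: `‖w_n - w‖_□ → 0` and `‖f_n - f‖₂ → 0`. -/
def ConvergesInNorm (wn : ℕ → Graphon μ) (fn : ℕ → Lp ℂ 2 μ) (w : Graphon μ) (f : Lp ℂ 2 μ) :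
    Prop :=
  Tendsto (fun n => cutNorm μ (fun x y => (wn n).toFun x y - w.toFun x y)) atTop (𝓝 0) ∧
    Tendsto (fun n => ‖fn n - f‖) atTop (𝓝 0)

end Fourier

/-! ### Graphs and graph signals, represented on `X` -/

/-- An isomorphism mod 0 between `[0,1]` and `(X, μ)`: measure-preserving maps in both directions,
measurable up to null sets and inverse to each other outside null sets. Such an isomorphism exists
exactly if `(X, μ)` is an atom-free standard probability space (completed or not). -/
structure IsoModZero {X : Type*} [MeasurableSpace X] (μ : Measure X) where
  toFun : unitInterval → X
  invFun : X → unitInterval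
  nullMeasurable_toFun : NullMeasurable toFun volume
  nullMeasurable_invFun : NullMeasurable invFun μ
  measure_toFun : ∀ s, MeasurableSet s → volume (toFun ⁻¹' s) = μ s
  measure_invFun : ∀ s, MeasurableSet s → μ (invFun ⁻¹' s) = volume s
  left_inv : ∀ᵐ t : unitInterval, invFun (toFun t) = t
  right_inv : ∀ᵐ x ∂μ, toFun (invFun x) = x

/-- The intervals `[k/N, (k+1)/N)`, `0 ≤ k < N`, that split `[0,1]`. -/
def cell (N : ℕ) (k : Fin N) : Set unitInterval :=
  {t : unitInterval | ((k : ℕ) : ℝ) / N ≤ (t : ℝ) ∧ (t : ℝ) < (((k : ℕ) : ℝ) + 1) / N}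

theorem measurableSet_cell (N : ℕ) (k : Fin N) : MeasurableSet (cell N k) :=
  (measurableSet_le measurable_const measurable_subtype_coe).inter
    (measurableSet_lt measurable_subtype_coe measurable_const)

open scoped Classical in
/-- The `0/1`-valued kernel `w_G` on `[0,1]²` of a graph with labels in `Fin N`. -/
def graphKernel {N : ℕ} (G : SimpleGraph (Fin N)) (s t : unitInterval) : ℝ :=
  if ∃ i j, G.Adj i j ∧ s ∈ cell N i ∧ t ∈ cell N j then 1 else 0

theorem measurable_graphKernel {N : ℕ} (G : SimpleGraph (Fin N)) :
    Measurable (fun p : unitInterval × unitInterval => graphKernel G p.1 p.2) := by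
  refine Measurable.ite ?_ measurable_const measurable_const
  have : {p : unitInterval × unitInterval | ∃ i j, G.Adj i j ∧ p.1 ∈ cell N i ∧ p.2 ∈ cell N j}
      = ⋃ i, ⋃ j, ⋃ _ : G.Adj i j, cell N i ×ˢ cell N j := by
    ext p
    simp only [Set.mem_ofPred_eq, Set.mem_iUnion, Set.mem_prod, exists_prop]
  rw [this]
  exact MeasurableSet.iUnion fun i => MeasurableSet.iUnion fun j => MeasurableSet.iUnion fun _ =>
    (measurableSet_cell N i).prod (measurableSet_cell N j)

/-- The step function on `[0,1]` with the value `√N f(k)` on the `k`-th interval. -/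
def stepSignal {N : ℕ} (f : EuclideanSpace ℂ (Fin N)) (t : unitInterval) : ℂ :=
  ((√(N : ℝ) : ℝ) : ℂ) * ∑ k, (cell N k).indicator (fun _ => f k) t

theorem measurable_stepSignal {N : ℕ} (f : EuclideanSpace ℂ (Fin N)) :
    Measurable (stepSignal f) :=
  (Finset.measurable_fun_sum _ fun k _ =>
    measurable_const.indicator (measurableSet_cell N k)).const_mul _

theorem norm_stepSignal_le {N : ℕ} (f : EuclideanSpace ℂ (Fin N)) (t : unitInterval) :
    ‖stepSignal f t‖ ≤ √(N : ℝ) * ∑ k, ‖f k‖ := by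
  rw [stepSignal, norm_mul, Complex.norm_real, Real.norm_of_nonneg (Real.sqrt_nonneg _)]
  gcongr
  refine (norm_sum_le _ _).trans (Finset.sum_le_sum fun k _ => ?_)
  exact norm_indicator_le_norm_self (fun _ => f k) t

section Represent

variable {X : Type*} [MeasurableSpace X] {μ : Measure X} [IsProbabilityMeasure μ]

/-- The graphon `w_{G,X}` on `X` of a labeled graph `G`:
`w_{G,X}(x, y) = w_G(σ⁻¹ x, σ⁻¹ y)`. -/
def graphGraphon (σ : IsoModZero μ) {N : ℕ} (G : SimpleGraph (Fin N)) : Graphon μ where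
  toFun x y := graphKernel G (σ.invFun x) (σ.invFun y)
  aemeasurable' := by
    have h : AEMeasurable σ.invFun μ := σ.nullMeasurable_invFun.aemeasurable
    exact (measurable_graphKernel G).comp_aemeasurable (h.comp_fst.prodMk h.comp_snd)
  mem_Icc' x y := by
    rw [graphKernel]
    split_ifs <;> simp
  symm' := Eventually.of_forall fun p => by
    have h : (∃ i j, G.Adj i j ∧ σ.invFun p.1 ∈ cell N i ∧ σ.invFun p.2 ∈ cell N j) ↔
        (∃ i j, G.Adj i j ∧ σ.invFun p.2 ∈ cell N i ∧ σ.invFun p.1 ∈ cell N j) :=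
      ⟨fun ⟨i, j, h, hi, hj⟩ => ⟨j, i, h.symm, hj, hi⟩,
        fun ⟨i, j, h, hi, hj⟩ => ⟨j, i, h.symm, hj, hi⟩⟩
    classical exact if_congr h rfl rfl

/-- The signal `f^X ∈ L²(X)` of a signal `f` on a labeled graph with `N` vertices: its value is
`√N f(k)` on the image under `σ` of the `k`-th interval. -/
def liftSignal (σ : IsoModZero μ) {N : ℕ} (f : EuclideanSpace ℂ (Fin N)) : Lp ℂ 2 μ :=
  MemLp.toLp (fun x => stepSignal f (σ.invFun x))
    (MemLp.of_bound
      ((measurable_stepSignal f).comp_aemeasurable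
        σ.nullMeasurable_invFun.aemeasurable).aestronglyMeasurable
      (√(N : ℝ) * ∑ k, ‖f k‖) (Eventually.of_forall fun _ => norm_stepSignal_le f _))

end Represent

open scoped Classical in
/-- The adjacency matrix divided by the number of vertices: this is the scaling for which the graph
shift operator agrees with the integral operator of the graphon of the graph. -/
def normAdjMatrix {N : ℕ} (G : SimpleGraph (Fin N)) : Matrix (Fin N) (Fin N) ℂ :=
  ((N : ℂ)⁻¹) • G.adjMatrix ℂ

/-- The graph shift operator on graph signals. -/
def graphShift {N : ℕ} (G : SimpleGraph (Fin N)) : Module.End ℂ (EuclideanSpace ℂ (Fin N)) :=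
  Matrix.toEuclideanLin (normAdjMatrix G)

/-- The polynomial graph filter `H = ∑ h_k A^k`. -/
def graphFilter {N : ℕ} (G : SimpleGraph (Fin N)) (h : Polynomial ℂ) :
    Matrix (Fin N) (Fin N) ℂ :=
  ∑ k ∈ Finset.range (h.natDegree + 1), h.coeff k • normAdjMatrix G ^ k

/-- The graph Fourier coefficient `⟨f, φ⟩ = ∑ f(v) conj(φ(v))`. -/
def graphFourier {N : ℕ} (f φ : EuclideanSpace ℂ (Fin N)) : ℂ :=
  ∑ v, f v * (starRingEnd ℂ) (φ v)

end

noncomputable section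

/-! ### Spectral subspaces of compact symmetric operators -/

section SpectralSubspaces

variable {E : Type*} [NormedAddCommGroup E] [InnerProductSpace ℂ E]

/-! Lifting graph signals to step functions is an isometry `J` into `L²(X)`, and the operator of the
graphon of `G` is `J A J*` (`op_graphGraphon_apply`). The problem thus lives on one Hilbert space,
with finite-rank symmetric operators `T_n` approaching `T_w`.

Cut-norm convergence of kernels with values in `[0,1]` forces operator-norm convergence
(`Graphon.norm_op_sub_op_le`), so `T_w` is compact and symmetric as a limit. Min-max in terms of
`upperSpace` then gives Weyl's inequality between the eigenvalues of `A_n` and those of `T_w` with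
the same index (`abs_orderedEigenvalue_sub_le`), and it shows that `I_ν` has as many elements as the
`ν`-eigenspace has dimensions (`exists_finset_eigenvalueIndices`).

For `i ∈ I_ν` the lifted eigenvectors are therefore orthonormal approximate eigenvectors of `T_w`
for `ν`. Since `T_w - ν` is bounded below modulo its kernel (`exists_norm_sub_starProjection_le`),
they approach the eigenspace, and because their number equals its dimension, the projections onto
their span converge strongly to the eigenprojection (`tendsto_sum_inner_smul`). The filtered signals
lift to `h(T_n) f_n^X`, which tends to `h(T_w) f`, and the eigenprojection turns `h(T_w)` into
`h(ν)`. -/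

/-- The span of the eigenspaces of `T` for the eigenvalues `≥ t`. -/
def upperSpace (T : Module.End ℂ E) (t : ℝ) : Submodule ℂ E :=
  ⨆ s ∈ Set.Ici t, T.eigenspace ((s : ℝ) : ℂ)

theorem upperSpace_antitone (T : Module.End ℂ E) : Antitone (upperSpace T) := fun _ _ hst =>
  biSup_mono fun _ h => le_trans hst h

theorem eigenspace_le_upperSpace (T : Module.End ℂ E) {s t : ℝ} (h : t ≤ s) :
    T.eigenspace (s : ℂ) ≤ upperSpace T t :=
  le_biSup (fun s : ℝ => T.eigenspace (s : ℂ)) (Set.mem_Ici.2 h)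

/-- Eigenspaces are pairwise orthogonal, so a finite eigenvector decomposition diagonalizes the norm
and the quadratic form together; `c s` is the squared norm of the component at `s`. Bounds on `S`
become bounds on the form. -/
theorem exists_weights_of_mem_iSup_eigenspace {T : Module.End ℂ E} (hT : T.IsSymmetric)
    {S : Set ℝ} {v : E} (hv : v ∈ ⨆ s ∈ S, T.eigenspace ((s : ℝ) : ℂ)) :
    ∃ (F : Finset S) (c : S → ℝ), (∀ s, 0 ≤ c s) ∧ ‖v‖ ^ 2 = ∑ s ∈ F, c s ∧
      (inner ℂ (T v) v).re = ∑ s ∈ F, (s : ℝ) * c s := by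
  classical
  rw [iSup_subtype', Submodule.mem_iSup_iff_exists_dfinsupp'] at hv
  obtain ⟨l, hl⟩ := hv
  have hV : OrthogonalFamily ℂ (fun s : S => T.eigenspace ((s : ℝ) : ℂ))
      fun s => (T.eigenspace ((s : ℝ) : ℂ)).subtypeₗᵢ :=
    hT.orthogonalFamily_eigenspaces.comp
      (Complex.ofReal_injective.comp Subtype.coe_injective)
  have hv : v = ∑ s ∈ l.support, ((l s : T.eigenspace ((s : ℝ) : ℂ)) : E) := by
    rw [← hl, DFinsupp.sum]
  have hTv : T v = ∑ s ∈ l.support,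
      (((((s : ℝ) : ℂ) • l s : T.eigenspace ((s : ℝ) : ℂ))) : E) := by
    rw [hv, map_sum]
    exact Finset.sum_congr rfl fun s _ => Module.End.mem_eigenspace_iff.1 (l s).2
  refine ⟨l.support, fun s => ‖l s‖ ^ 2, fun s => sq_nonneg _, ?_, ?_⟩
  · rw [hv]
    exact hV.norm_sum (fun s => l s) l.support
  · have h := hV.inner_sum (fun s => ((s : ℝ) : ℂ) • l s) (fun s => l s) l.support
    rw [hTv]
    nth_rewrite 1 [hv]
    refine (congrArg Complex.re h).trans ?_
    rw [Complex.re_sum]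
    refine Finset.sum_congr rfl fun s _ => ?_
    rw [inner_smul_left, Complex.conj_ofReal, Complex.re_ofReal_mul, inner_self_eq_norm_sq_to_K]
    norm_cast

theorem le_re_inner_of_mem_upperSpace {T : Module.End ℂ E} (hT : T.IsSymmetric) {t : ℝ} {v : E}
    (hv : v ∈ upperSpace T t) : t * ‖v‖ ^ 2 ≤ (inner ℂ (T v) v).re := by
  obtain ⟨F, c, hc, h1, h2⟩ := exists_weights_of_mem_iSup_eigenspace hT hv
  rw [h1, h2, Finset.mul_sum]
  exact Finset.sum_le_sum fun s _ => mul_le_mul_of_nonneg_right s.2 (hc s)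

theorem isOrtho_eigenspace_upperSpace {T : Module.End ℂ E} (hT : T.IsSymmetric) {s t : ℝ}
    (h : s < t) : T.eigenspace (s : ℂ) ⟂ upperSpace T t := by
  rw [upperSpace, Submodule.isOrtho_iSup_right]
  intro u
  rw [Submodule.isOrtho_iSup_right]
  intro hu
  exact hT.orthogonalFamily_eigenspaces.isOrtho fun h' =>
    (h.trans_le hu).ne (Complex.ofReal_injective h')

variable [CompleteSpace E] {T : E →L[ℂ] E}

/-- By the spectral theorem `Wᗮ` lies in the closure of the span `K` of the eigenspaces below `t`.
The inequality holds on `K` and is a closed condition. -/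
theorem re_inner_le_of_mem_orthogonal_upperSpace (hc : IsCompactOperator T)
    (hs : (T : Module.End ℂ E).IsSymmetric) {t : ℝ} {v : E}
    (hv : v ∈ (upperSpace (T : Module.End ℂ E) t)ᗮ) :
    (inner ℂ (T v) v).re ≤ t * ‖v‖ ^ 2 := by
  set W := upperSpace (T : Module.End ℂ E) t
  set K : Submodule ℂ E := ⨆ s ∈ Set.Iio t, Module.End.eigenspace (T : Module.End ℂ E) ((s : ℝ) : ℂ) with hK
  have hKW : K ≤ Wᗮ := by
    refine iSup₂_le fun s hst => ?_
    exact isOrtho_eigenspace_upperSpace hs hst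
  -- All eigenvalues are real, so each eigenspace lies in `W` or in `K`.
  have htop : (W ⊔ K)ᗮ = ⊥ := by
    rw [eq_bot_iff, ← ContinuousLinearMap.orthogonalComplement_iSup_eigenspaces_eq_bot hc hs]
    refine Submodule.orthogonal_le (iSup_le fun z => ?_)
    by_cases hz : Module.End.HasEigenvalue (T : Module.End ℂ E) z
    · obtain ⟨s, rfl⟩ : ∃ s : ℝ, (s : ℂ) = z :=
        Complex.conj_eq_iff_real.1 (hs.conj_eigenvalue_eq_self hz) |>.imp fun _ h => h.symm
      rcases le_or_gt t s with h | h
      · exact (eigenspace_le_upperSpace _ h).trans le_sup_left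
      · exact (le_biSup (fun s : ℝ => Module.End.eigenspace (T : Module.End ℂ E) (s : ℂ))
          (Set.mem_Iio.2 h)).trans le_sup_right
    · rw [Module.End.hasEigenvalue_iff, not_not] at hz
      rw [hz]
      exact bot_le
  have hKc : K.topologicalClosure ≤ Wᗮ :=
    K.topologicalClosure_minimal hKW (Submodule.isClosed_orthogonal W)
  have : CompleteSpace K.topologicalClosure := K.isClosed_topologicalClosure.completeSpace_coe
  have hmem : v - K.topologicalClosure.starProjection v ∈ (W ⊔ K)ᗮ := by
    rw [← Submodule.inf_orthogonal]
    refine ⟨Submodule.sub_mem _ hv (hKc (Submodule.starProjection_apply_mem _ v)), ?_⟩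
    exact Submodule.orthogonal_le K.le_topologicalClosure
      (K.topologicalClosure.sub_starProjection_mem_orthogonal v)
  rw [htop, Submodule.mem_bot, sub_eq_zero] at hmem
  have hvK : v ∈ closure (K : Set E) := by
    rw [hmem]
    exact Submodule.starProjection_apply_mem K.topologicalClosure v
  have hclosed : IsClosed {u : E | (inner ℂ (T u) u).re ≤ t * ‖u‖ ^ 2} :=
    isClosed_le (by fun_prop) (by fun_prop)
  refine closure_minimal (fun u hu => ?_) hclosed hvK
  obtain ⟨F, c, hc, h1, h2⟩ := exists_weights_of_mem_iSup_eigenspace hs hu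
  change (inner ℂ ((T : Module.End ℂ E) u) u).re ≤ _
  rw [h1, h2, Finset.mul_sum]
  exact Finset.sum_le_sum fun s _ => mul_le_mul_of_nonneg_right (le_of_lt s.2) (hc s)

/-- `T` is bounded below by `t` on the closure of this space, hence restricts to a closed embedding.
Compactness of `T` then makes the unit ball compact, and Riesz's theorem applies. -/
theorem finiteDimensional_upperSpace (hc : IsCompactOperator T)
    (hs : (T : Module.End ℂ E).IsSymmetric) {t : ℝ} (ht : 0 < t) :
    FiniteDimensional ℂ (upperSpace (T : Module.End ℂ E) t) := by
  set W := upperSpace (T : Module.End ℂ E) t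
  have hlow : ∀ v ∈ W.topologicalClosure, t * ‖v‖ ≤ ‖T v‖ := by
    have hclosed : IsClosed {u : E | t * ‖u‖ ≤ ‖T u‖} := isClosed_le (by fun_prop) (by fun_prop)
    intro v hv
    refine closure_minimal (fun u hu => ?_) hclosed hv
    have h1 : t * ‖u‖ ^ 2 ≤ (inner ℂ (T u) u).re := le_re_inner_of_mem_upperSpace hs hu
    have h2 : (inner ℂ (T u) u).re ≤ ‖T u‖ * ‖u‖ := re_inner_le_norm (𝕜 := ℂ) _ _
    rcases (norm_nonneg u).eq_or_lt with h | h
    · change t * ‖u‖ ≤ ‖T u‖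
      rw [← h, mul_zero]
      exact norm_nonneg _
    · exact le_of_mul_le_mul_right (by nlinarith) h
  have : CompleteSpace W.topologicalClosure := W.isClosed_topologicalClosure.completeSpace_coe
  set S : W.topologicalClosure →L[ℂ] E := T ∘L W.topologicalClosure.subtypeL
  have hS : IsCompactOperator S := hc.comp_clm W.topologicalClosure.subtypeL
  have hanti : AntilipschitzWith (t.toNNReal⁻¹) S := by
    refine ContinuousLinearMap.antilipschitz_of_bound S fun v => ?_
    have := hlow v v.2
    rw [NNReal.coe_inv, Real.coe_toNNReal t ht.le, ← div_eq_inv_mul, le_div_iff₀ ht, mul_comm]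
    exact this
  have hemb := hanti.isClosedEmbedding S.uniformContinuous
  have hball : IsCompact (Metric.closedBall (0 : W.topologicalClosure) 1) := by
    refine (hemb.isCompact_preimage (hS.isCompact_closure_image_closedBall 1)).of_isClosed_subset
      Metric.isClosed_closedBall ?_
    exact (Set.subset_preimage_image _ _).trans (Set.preimage_mono subset_closure)
  have := FiniteDimensional.of_isCompact_closedBall ℂ one_pos hball
  exact Submodule.finiteDimensional_of_le W.le_topologicalClosure

/-- One half of the min-max principle. -/
theorem rank_le_rank_upperSpace (hc : IsCompactOperator T)
    (hs : (T : Module.End ℂ E).IsSymmetric) {s t : ℝ} (ht : 0 < t) (hst : t < s)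
    {V : Submodule ℂ E} (hV : ∀ v ∈ V, s * ‖v‖ ^ 2 ≤ (inner ℂ (T v) v).re) :
    Module.rank ℂ V ≤ Module.rank ℂ (upperSpace (T : Module.End ℂ E) t) := by
  have := finiteDimensional_upperSpace hc hs ht
  set W := upperSpace (T : Module.End ℂ E) t
  -- The projection onto `W` is injective on `V`: on `Wᗮ` the form is at most `t‖v‖²`, on `V` it is
  -- at least `s‖v‖²`, and `t < s`.
  refine LinearMap.rank_le_of_injective
    ((W.orthogonalProjectionOnto : E →L[ℂ] W).toLinearMap ∘ₗ V.subtype) ?_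
  rw [← LinearMap.ker_eq_bot, LinearMap.ker_eq_bot']
  intro v hv
  have hv' : (v : E) ∈ Wᗮ := Submodule.orthogonalProjectionOnto_eq_zero_iff.1 hv
  have h1 := re_inner_le_of_mem_orthogonal_upperSpace hc hs hv'
  have h2 := hV v v.2
  have h3 : ‖(v : E)‖ ^ 2 ≤ 0 := by nlinarith [sq_nonneg ‖(v : E)‖]
  have h4 : ‖(v : E)‖ = 0 := by nlinarith [sq_nonneg ‖(v : E)‖]
  exact Subtype.ext (norm_eq_zero.1 h4)

end SpectralSubspaces

/-! ### Ordered eigenvalues of compact symmetric operators -/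

section OrderedEigenvalues

variable {E : Type*} [NormedAddCommGroup E] [InnerProductSpace ℂ E] [CompleteSpace E]
  {T : E →L[ℂ] E}

/-- The dimension of `upperSpace` is a natural number, so it attains its minimum on `(0, t)`, and
the space is constant from there up to `t`. An eigenvalue in this range would make it jump. -/
theorem exists_lt_upperSpace_eq (hc : IsCompactOperator T)
    (hs : (T : Module.End ℂ E).IsSymmetric) {t : ℝ} (ht : 0 < t) :
    ∃ s, 0 < s ∧ s < t ∧
      upperSpace (T : Module.End ℂ E) s = upperSpace (T : Module.End ℂ E) t := by
  set W := upperSpace (T : Module.End ℂ E)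
  set A : Set ℕ := (fun s => Module.finrank ℂ (W s)) '' Set.Ioo 0 t
  have hA : A.Nonempty := (Set.nonempty_Ioo.2 ht).image _
  obtain ⟨s, hst, hsA⟩ := Nat.sInf_mem hA
  have hfin := finiteDimensional_upperSpace hc hs hst.1
  have hconst : ∀ u, s ≤ u → u < t → W u = W s := fun u hsu hut =>
    Submodule.eq_of_le_of_finrank_le (upperSpace_antitone _ hsu)
      (hsA.trans_le (Nat.sInf_le ⟨u, ⟨hst.1.trans_le hsu, hut⟩, rfl⟩))
  refine ⟨s, hst.1, hst.2, le_antisymm (iSup₂_le fun u hu => ?_) (upperSpace_antitone _ hst.2.le)⟩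
  rcases le_or_gt t u with h | h
  · exact eigenspace_le_upperSpace _ h
  -- The eigenspace at `u` is orthogonal to `W v`, but also contained in it since `W v = W s`; hence
  -- it is zero.
  · obtain ⟨v, huv, hvt⟩ := exists_between h
    have h1 := isOrtho_eigenspace_upperSpace hs huv
    have h2 : Module.End.eigenspace (T : Module.End ℂ E) (u : ℂ) ≤ W v := by
      rw [hconst v (le_trans hu huv.le) hvt]
      exact eigenspace_le_upperSpace _ hu
    rw [Submodule.isOrtho_self.1 (h1.mono_right h2)]
    exact bot_le

/-- The dimensions beyond `t` are bounded by that at `t`, so a largest one is attained at some `s`.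
Then `W s` contains every eigenspace beyond `t`, and only the orthogonal `t`-eigenspace separates it
from `W t`. -/
theorem exists_gt_upperSpace_eq (hc : IsCompactOperator T)
    (hs : (T : Module.End ℂ E).IsSymmetric) {t : ℝ} (ht : 0 < t) :
    ∃ s, t < s ∧
      (∀ u, t < u → upperSpace (T : Module.End ℂ E) u ≤ upperSpace (T : Module.End ℂ E) s) ∧
      Module.finrank ℂ (upperSpace (T : Module.End ℂ E) t) =
        Module.finrank ℂ (Module.End.eigenspace (T : Module.End ℂ E) (t : ℂ)) +
        Module.finrank ℂ (upperSpace (T : Module.End ℂ E) s) := by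
  have hfin := finiteDimensional_upperSpace hc hs ht
  set W := upperSpace (T : Module.End ℂ E) with hW
  set A : Set ℕ := (fun s => Module.finrank ℂ (W s)) '' Set.Ioi t
  have hA : A.Nonempty := Set.nonempty_Ioi.image _
  have hbdd : BddAbove A := by
    refine ⟨Module.finrank ℂ (W t), ?_⟩
    rintro _ ⟨u, hu, rfl⟩
    exact Submodule.finrank_mono (upperSpace_antitone _ (le_of_lt hu))
  obtain ⟨s, hst, hsA⟩ := Nat.sSup_mem hA hbdd
  have hst : t < s := hst
  have hle : ∀ u, t < u → W u ≤ W s := by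
    intro u hu
    rcases le_or_gt s u with h | h
    · exact upperSpace_antitone _ h
    · have := finiteDimensional_upperSpace hc hs (ht.trans hu)
      refine (Submodule.eq_of_le_of_finrank_le (upperSpace_antitone _ h.le) ?_).ge
      exact (le_csSup hbdd ⟨u, hu, rfl⟩).trans hsA.ge
  have hsup : Module.End.eigenspace (T : Module.End ℂ E) (t : ℂ) ⊔ W s = W t := by
    refine le_antisymm (sup_le (eigenspace_le_upperSpace _ le_rfl)
      (upperSpace_antitone _ hst.le)) (iSup₂_le fun u hu => ?_)
    rcases (show t ≤ u from hu).eq_or_lt with h | h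
    · rw [h]
      exact le_sup_left
    · exact ((eigenspace_le_upperSpace _ le_rfl).trans (hle u h)).trans le_sup_right
  have hinf : Module.End.eigenspace (T : Module.End ℂ E) (t : ℂ) ⊓ W s = ⊥ :=
    (isOrtho_eigenspace_upperSpace hs hst).disjoint.eq_bot
  refine ⟨s, hst, hle, ?_⟩
  have := finiteDimensional_upperSpace hc hs (ht.trans hst)
  have : FiniteDimensional ℂ (Module.End.eigenspace (T : Module.End ℂ E) (t : ℂ)) :=
    Submodule.finiteDimensional_of_le (eigenspace_le_upperSpace _ le_rfl)
  have h := Submodule.finrank_sup_add_finrank_inf_eq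
    (Module.End.eigenspace (T : Module.End ℂ E) (t : ℂ)) (W s)
  rwa [hsup, hinf, finrank_bot, add_zero] at h

/-- The supremum in `posEigenvalue` is attained because `upperSpace` is constant just below `t`.
This turns statements about ordered eigenvalues into dimension counts. For `k = 0` the set would be
unbounded. -/
theorem le_posEigenvalue_iff (hc : IsCompactOperator T)
    (hs : (T : Module.End ℂ E).IsSymmetric) {t : ℝ} (ht : 0 < t) {k : ℕ} (hk : 0 < k) :
    t ≤ posEigenvalue (T : Module.End ℂ E) k ↔
      (k : Cardinal) ≤ Module.rank ℂ (upperSpace (T : Module.End ℂ E) t) := by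
  set A : Set ℝ := {t : ℝ | 0 < t ∧
    (k : Cardinal) ≤ Module.rank ℂ (upperSpace (T : Module.End ℂ E) t)} with hA
  have hdef : posEigenvalue (T : Module.End ℂ E) k = sSup A := rfl
  have hbdd : BddAbove A := by
    refine ⟨‖T‖, fun u hu => ?_⟩
    have hpos : 0 < Module.rank ℂ (upperSpace (T : Module.End ℂ E) u) :=
      lt_of_lt_of_le (by exact_mod_cast hk) hu.2
    have : Nontrivial (upperSpace (T : Module.End ℂ E) u) := rank_pos_iff_nontrivial.1 hpos
    obtain ⟨⟨v, hv⟩, hv0⟩ := exists_ne (0 : upperSpace (T : Module.End ℂ E) u)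
    have hv0 : 0 < ‖v‖ := norm_pos_iff.2 fun h => hv0 (Subtype.ext h)
    have h1 := le_re_inner_of_mem_upperSpace hs hv
    have h2 : (inner ℂ (T v) v).re ≤ ‖T v‖ * ‖v‖ := re_inner_le_norm (𝕜 := ℂ) _ _
    have h3 := T.le_opNorm v
    have h4 : u * ‖v‖ ^ 2 ≤ ‖T‖ * ‖v‖ ^ 2 :=
      h1.trans (h2.trans (by nlinarith))
    exact le_of_mul_le_mul_right h4 (by positivity)
  rw [hdef]
  refine ⟨fun h => ?_, fun h => le_csSup hbdd ⟨ht, h⟩⟩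
  obtain ⟨s, hs0, hst, hW⟩ := exists_lt_upperSpace_eq hc hs ht
  -- The supremum of the empty set is `0` in `ℝ`, which contradicts `0 < t`.
  have hne : A.Nonempty := by
    by_contra hne
    rw [Set.not_nonempty_iff_eq_empty.1 hne, Real.sSup_empty] at h
    exact absurd h (not_le.2 ht)
  obtain ⟨u, hu, hsu⟩ := exists_lt_of_lt_csSup hne (hst.trans_le h)
  rw [← hW]
  exact hu.2.trans (Submodule.rank_mono (upperSpace_antitone _ hsu.le))

/-- An eigenvalue `ν > 0` occurs in the ordered list as often as its multiplicity says. -/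
theorem exists_finset_posEigenvalue_eq (hc : IsCompactOperator T)
    (hs : (T : Module.End ℂ E).IsSymmetric) {ν : ℝ} (hν : 0 < ν) :
    ∃ K : Finset ℕ, (∀ k, k ∈ K ↔ 0 < k ∧ posEigenvalue (T : Module.End ℂ E) k = ν) ∧
      K.card = Module.finrank ℂ (Module.End.eigenspace (T : Module.End ℂ E) (ν : ℂ)) := by
  obtain ⟨s, hνs, hle, hadd⟩ := exists_gt_upperSpace_eq hc hs hν
  have hf1 := finiteDimensional_upperSpace hc hs hν
  have hf2 := finiteDimensional_upperSpace hc hs (hν.trans hνs)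
  -- The `k`-th eigenvalue is at least `ν` iff `k ≤ dim W ν`, and exceeds `ν` iff `k ≤ dim W s`.
  refine ⟨Finset.Ioc (Module.finrank ℂ (upperSpace (T : Module.End ℂ E) s))
    (Module.finrank ℂ (upperSpace (T : Module.End ℂ E) ν)), fun k => ?_, ?_⟩
  · rw [Finset.mem_Ioc]
    rcases Nat.eq_zero_or_pos k with rfl | hk
    · simp
    have h1 := le_posEigenvalue_iff hc hs hν hk
    have h2 := le_posEigenvalue_iff hc hs (hν.trans hνs) hk
    rw [← Module.finrank_eq_rank, Nat.cast_le] at h1 h2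
    rw [← h1, ← not_le, ← h2]
    constructor
    · rintro ⟨h3, h4⟩
      refine ⟨hk, le_antisymm (not_lt.1 fun h5 => h3 ?_) h4⟩
      rw [le_posEigenvalue_iff hc hs (hν.trans hνs) hk]
      have h6 := (le_posEigenvalue_iff hc hs (hν.trans h5) hk).1 le_rfl
      exact h6.trans (Submodule.rank_mono (hle _ h5))
    · rintro ⟨-, h⟩
      rw [h]
      exact ⟨not_le.2 hνs, le_rfl⟩
  · rw [Nat.card_Ioc, hadd, Nat.add_sub_cancel]

variable {F : Type*} [NormedAddCommGroup F] [InnerProductSpace ℂ F] [CompleteSpace F]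
  {S : F →L[ℂ] F}

/-- Comparison of ordered eigenvalues through a contraction that almost preserves the quadratic
forms. -/
theorem le_posEigenvalue_of_form_le (hTc : IsCompactOperator T)
    (hTs : (T : Module.End ℂ E).IsSymmetric) (hSc : IsCompactOperator S)
    (hSs : (S : Module.End ℂ F).IsSymmetric) (L : E →ₗ[ℂ] F) (hL : ∀ v, ‖L v‖ ≤ ‖v‖) {ε : ℝ}
    (hLT : ∀ v, (inner ℂ (T v) v).re - ε * ‖v‖ ^ 2 ≤ (inner ℂ (S (L v)) (L v)).re)
    {s t : ℝ} (hs : 0 < s) (ht : 0 < t) (hst : s < t - ε) {k : ℕ} (hk : 0 < k)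
    (h : t ≤ posEigenvalue (T : Module.End ℂ E) k) :
    s ≤ posEigenvalue (S : Module.End ℂ F) k := by
  rw [le_posEigenvalue_iff hTc hTs ht hk] at h
  rw [le_posEigenvalue_iff hSc hSs hs hk]
  set V := upperSpace (T : Module.End ℂ E) t
  have hV : ∀ v ∈ V, (t - ε) * ‖v‖ ^ 2 ≤ (inner ℂ (S (L v)) (L v)).re := fun v hv => by
    have h1 : t * ‖v‖ ^ 2 ≤ (inner ℂ (T v) v).re := le_re_inner_of_mem_upperSpace hTs hv
    linarith [hLT v]
  -- On `V` the form pulled back by `L` is at least `(t - ε)‖v‖²` with `t - ε > 0`, so `L` kills no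
  -- nonzero vector.
  have hinj : Function.Injective (L.domRestrict V) := by
    rw [← LinearMap.ker_eq_bot, LinearMap.ker_eq_bot']
    intro v hv
    have hv' : L v = 0 := hv
    have h1 := hV v v.2
    rw [hv', inner_zero_right, Complex.zero_re] at h1
    have h2 : ‖(v : E)‖ ^ 2 ≤ 0 := by
      by_contra h2
      nlinarith
    exact Subtype.ext (norm_eq_zero.1 (by nlinarith [sq_nonneg ‖(v : E)‖]))
  have hrank := rank_le_rank_upperSpace hSc hSs hs hst (V := V.map L) (by
    rintro _ ⟨v, hv, rfl⟩
    have h1 := hL v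
    have h2 : ‖L v‖ ^ 2 ≤ ‖v‖ ^ 2 := by gcongr
    exact (mul_le_mul_of_nonneg_left h2 (by linarith)).trans (hV v hv))
  have := finiteDimensional_upperSpace hTc hTs ht
  have := finiteDimensional_upperSpace hSc hSs hs
  have hfr : Module.finrank ℂ (V.map L) = Module.finrank ℂ V := by
    rw [← LinearMap.range_domRestrict]
    exact LinearMap.finrank_range_of_inj hinj
  rw [← Module.finrank_eq_rank, Nat.cast_le] at h ⊢
  rw [← Module.finrank_eq_rank, ← Module.finrank_eq_rank, Nat.cast_le] at hrank
  omega

end OrderedEigenvalues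

/-! ### Perturbation of eigenvalues and of spectral projections -/

section Perturbation

variable {E : Type*} [NormedAddCommGroup E] [InnerProductSpace ℂ E] {T : E →L[ℂ] E}

theorem Orthonormal.norm_sub_sum_sq {ι : Type*} [Fintype ι] {ψ : ι → E} (h : Orthonormal ℂ ψ)
    (e : E) :
    ‖e - ∑ i, inner ℂ (ψ i) e • ψ i‖ ^ 2 = ‖e‖ ^ 2 - ∑ i, ‖inner ℂ (ψ i) e‖ ^ 2 := by
  have h1 : (inner ℂ e (∑ i, inner ℂ (ψ i) e • ψ i)).re = ∑ i, ‖inner ℂ (ψ i) e‖ ^ 2 := by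
    rw [inner_sum, Complex.re_sum]
    refine Finset.sum_congr rfl fun i _ => ?_
    rw [inner_smul_right, ← inner_conj_symm e, Complex.mul_conj, Complex.ofReal_re,
      Complex.normSq_eq_norm_sq]
  have h2 : ‖∑ i, inner ℂ (ψ i) e • ψ i‖ ^ 2 = ∑ i, ‖inner ℂ (ψ i) e‖ ^ 2 := by
    rw [← inner_self_eq_norm_sq (𝕜 := ℂ), h.inner_sum, RCLike.re_eq_complex_re, Complex.re_sum]
    refine Finset.sum_congr rfl fun i _ => ?_
    rw [mul_comm, Complex.mul_conj, Complex.ofReal_re, Complex.normSq_eq_norm_sq]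
  rw [norm_sub_sq (𝕜 := ℂ), h2, RCLike.re_eq_complex_re, h1]
  ring

theorem abs_re_inner_sub_le {T' : E →L[ℂ] E} {ε : ℝ} (h : ‖T' - T‖ ≤ ε) (v : E) :
    |(inner ℂ (T' v) v).re - (inner ℂ (T v) v).re| ≤ ε * ‖v‖ ^ 2 := by
  rw [← Complex.sub_re, ← inner_sub_left]
  refine (Complex.abs_re_le_norm _).trans ((norm_inner_le_norm _ _).trans ?_)
  have h1 := (T' - T).le_of_opNorm_le h v
  rw [sub_apply] at h1
  nlinarith [norm_nonneg v]

variable [CompleteSpace E] {F : Type*} [NormedAddCommGroup F] [InnerProductSpace ℂ F] [CompleteSpace F]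

/-- Weyl's perturbation inequality for the positive eigenvalues of a compression. -/
theorem abs_posEigenvalue_sub_le (hTc : IsCompactOperator T)
    (hTs : (T : Module.End ℂ E).IsSymmetric) {A : F →L[ℂ] F} (hAc : IsCompactOperator A)
    (hAs : (A : Module.End ℂ F).IsSymmetric) (J : F →ₗᵢ[ℂ] E) {T' : E →L[ℂ] E}
    (hT' : ∀ v, T' v = J (A (ContinuousLinearMap.adjoint J.toContinuousLinearMap v)))
    {ε δ : ℝ} (h : ‖T' - T‖ ≤ ε) (hεδ : ε < δ) {k : ℕ} (hk : 0 < k)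
    (hδ : δ < posEigenvalue (T : Module.End ℂ E) k) :
    |posEigenvalue (A : Module.End ℂ F) k - posEigenvalue (T : Module.End ℂ E) k| ≤ δ := by
  set B := ContinuousLinearMap.adjoint J.toContinuousLinearMap
  set t := posEigenvalue (T : Module.End ℂ E) k
  have hε : 0 ≤ ε := (norm_nonneg _).trans h
  have hBJ : ∀ u, B (J u) = u := fun u =>
    DFunLike.congr_fun (J.adjoint_comp_self) u
  have hBn : ∀ v, ‖B v‖ ≤ ‖v‖ := fun v => by
    refine (B.le_of_opNorm_le (c := 1) ?_ v).trans (one_mul _).le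
    rw [LinearIsometryEquiv.norm_map]
    exact J.norm_toContinuousLinearMap_le
  have hform : ∀ v, (inner ℂ (T' v) v) = inner ℂ (A (B v)) (B v) := fun v => by
    rw [hT']
    exact (ContinuousLinearMap.adjoint_inner_right J.toContinuousLinearMap _ _).symm
  rw [abs_le]
  constructor
  -- Lower bound: the contraction `B = J*` carries the form of `T'` to that of `A`.
  · have := le_posEigenvalue_of_form_le hTc hTs hAc hAs (B : E →ₗ[ℂ] F) hBn (ε := ε)
      (s := t - δ) (t := t) (fun v => by
        have h1 := abs_le.1 (abs_re_inner_sub_le h v)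
        rw [hform] at h1
        simp only [ContinuousLinearMap.coe_coe]
        linarith [h1.1]) (by linarith) (by linarith) (by linarith) hk le_rfl
    linarith
  · by_contra hcon
    -- Upper bound: now `J` carries the form of `A` to that of `T'`. The level `t + (δ - ε) / 2`
    -- lies strictly between `t` and `t + δ - ε`, so the conclusion contradicts the definition of
    -- `t`.
    have := le_posEigenvalue_of_form_le hAc hAs hTc hTs J.toLinearMap (fun v => (J.norm_map v).le)
      (ε := ε) (s := t + (δ - ε) / 2) (t := t + δ) (fun v => by
        have h1 := abs_le.1 (abs_re_inner_sub_le h (J v))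
        rw [hform, hBJ, J.norm_map] at h1
        simp only [LinearIsometry.coe_toLinearMap]
        linarith [h1.2]) (by linarith) (by linarith) (by linarith) hk (by linarith)
    linarith

instance completeSpace_eigenspace (T : E →L[ℂ] E) (z : ℂ) :
    CompleteSpace (Module.End.eigenspace (T : Module.End ℂ E) z) := by
  have h : Module.End.eigenspace (T : Module.End ℂ E) z
      = LinearMap.ker (T - z • ContinuousLinearMap.id ℂ E).toLinearMap := by
    ext ξ
    rw [Module.End.mem_eigenspace_iff, LinearMap.mem_ker]
    exact sub_eq_zero.symm
  have hc : IsClosed (Module.End.eigenspace (T : Module.End ℂ E) z : Set E) := by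
    rw [h]
    exact ContinuousLinearMap.isClosed_ker _
  exact hc.completeSpace_coe

theorem starProjection_eigenspace_apply (hTs : (T : Module.End ℂ E).IsSymmetric) (ν : ℝ) (v : E) :
    (Module.End.eigenspace (T : Module.End ℂ E) (ν : ℂ)).starProjection (T v) =
      (ν : ℂ) • (Module.End.eigenspace (T : Module.End ℂ E) (ν : ℂ)).starProjection v := by
  set V := Module.End.eigenspace (T : Module.End ℂ E) (ν : ℂ)
  refine Submodule.eq_starProjection_of_mem_of_inner_eq_zero
    (V.smul_mem _ (V.starProjection_apply_mem v)) fun e he => ?_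
  have h1 : inner ℂ (T v) e = inner ℂ v (T e) := hTs v e
  have h2 : T e = (ν : ℂ) • e := Module.End.mem_eigenspace_iff.1 he
  have h3 : inner ℂ (v - V.starProjection v) e = 0 := V.starProjection_inner_eq_zero v e he
  rw [inner_sub_left] at h3 ⊢
  rw [h1, h2, inner_smul_right, inner_smul_left, Complex.conj_ofReal, ← mul_sub, h3, mul_zero]

/-- A compact symmetric operator minus a nonzero scalar is bounded below modulo its kernel. -/
theorem exists_norm_sub_starProjection_le (hTc : IsCompactOperator T)
    (hTs : (T : Module.End ℂ E).IsSymmetric) {ν : ℝ} (hν : ν ≠ 0) :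
    ∃ C : ℝ, ∀ v,
      ‖v - (Module.End.eigenspace (T : Module.End ℂ E) (ν : ℂ)).starProjection v‖ ≤
        C * ‖T v - (ν : ℂ) • v‖ := by
  set V := Module.End.eigenspace (T : Module.End ℂ E) (ν : ℂ) with hV
  have hν' : (ν : ℂ) ≠ 0 := Complex.ofReal_ne_zero.2 hν
  set Q : E →L[ℂ] E := ContinuousLinearMap.id ℂ E - V.starProjection with hQ
  have hQv : ∀ v, Q v = v - V.starProjection v := fun v => rfl
  have hTP : ∀ v, T (V.starProjection v) = (ν : ℂ) • V.starProjection v := fun v =>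
    Module.End.mem_eigenspace_iff.1 (V.starProjection_apply_mem v)
  have hPP : ∀ v, V.starProjection (V.starProjection v) = V.starProjection v := fun v =>
    Submodule.starProjection_eq_self_iff.2 (V.starProjection_apply_mem v)
  have hcomp : IsCompactOperator (T ∘L Q) := hTc.comp_clm Q
  -- With `P` the eigenprojection and `Q = 1 - P`: if `T Q v = ν v`, applying `P` gives `P v = 0`,
  -- so `T v = ν v` and `v = P v = 0`. The Fredholm alternative then bounds `T Q - ν` from below.
  have hno : ¬ Module.End.HasEigenvalue ((T ∘L Q : E →L[ℂ] E) : Module.End ℂ E) (ν : ℂ) := by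
    intro h
    obtain ⟨v, hv, hv0⟩ := h.exists_hasEigenvector
    have hv : T (Q v) = (ν : ℂ) • v := Module.End.mem_eigenspace_iff.1 hv
    have h1 := congrArg V.starProjection hv
    rw [starProjection_eigenspace_apply hTs, hQv, map_sub, hPP, sub_self, smul_zero, map_smul,
      eq_comm, smul_eq_zero] at h1
    have h1 := h1.resolve_left hν'
    have h2 : v ∈ V := by
      rw [hQv, h1, sub_zero] at hv
      exact Module.End.mem_eigenspace_iff.2 hv
    rw [Submodule.starProjection_eq_self_iff.2 h2] at h1
    exact hv0 h1
  obtain ⟨K, hK⟩ := hcomp.antilipschitz_of_not_hasEigenvalue hν' hno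
  refine ⟨K, fun v => ?_⟩
  -- At `Q v` the operator `T Q - ν` takes the value `T v - ν v`.
  have h := hK.le_mul_dist (Q v) 0
  rw [map_zero, dist_zero_right, dist_zero_right, hQv] at h
  refine h.trans_eq ?_
  congr 2
  simp only [sub_apply, ContinuousLinearMap.comp_apply, hQv, map_sub, hPP, hTP, smul_apply, one_apply_eq_self, sub_self, map_zero]
  abel

/-- If `d` orthonormal vectors are asymptotically eigenvectors for an eigenvalue `ν ≠ 0` of
multiplicity `d`, then the projections onto their spans converge strongly to the projection
onto the eigenspace. -/
theorem tendsto_sum_inner_smul (hTc : IsCompactOperator T)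
    (hTs : (T : Module.End ℂ E).IsSymmetric) {ν : ℝ} (hν : ν ≠ 0) {ι : Type*} [Fintype ι]
    (hcard : Fintype.card ι =
      Module.finrank ℂ (Module.End.eigenspace (T : Module.End ℂ E) (ν : ℂ)))
    {ψ : ℕ → ι → E} (ho : ∀ᶠ n in atTop, Orthonormal ℂ (ψ n))
    (hψ : ∀ i, Tendsto (fun n => T (ψ n i) - (ν : ℂ) • ψ n i) atTop (𝓝 0))
    {g : ℕ → E} {g₀ : E} (hg : Tendsto g atTop (𝓝 g₀)) :
    Tendsto (fun n => ∑ i, inner ℂ (ψ n i) (g n) • ψ n i) atTop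
      (𝓝 ((Module.End.eigenspace (T : Module.End ℂ E) (ν : ℂ)).starProjection g₀)) := by
  set V := Module.End.eigenspace (T : Module.End ℂ E) (ν : ℂ) with hV
  have hfin : FiniteDimensional ℂ V :=
    T.finite_dimensional_eigenspace hTc _ (Complex.ofReal_ne_zero.2 hν)
  obtain ⟨C, hC⟩ := exists_norm_sub_starProjection_le hTc hTs hν
  -- Once the `ψ n i` are orthonormal, `S n` is the orthogonal projection onto their span.
  set S : ℕ → E →L[ℂ] E := fun n => ∑ i, (innerSL ℂ (ψ n i)).smulRight (ψ n i) with hS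
  have hSv : ∀ n v, S n v = ∑ i, inner ℂ (ψ n i) v • ψ n i := fun n v => by
    simp [hS]
  have hres : ∀ i, Tendsto (fun n => ψ n i - V.starProjection (ψ n i)) atTop (𝓝 0) := by
    intro i
    refine squeeze_zero_norm (fun n => hC (ψ n i)) ?_
    simpa using (hψ i).norm.const_mul C
  have hnorm : ∀ i, Tendsto (fun n => ‖V.starProjection (ψ n i)‖ ^ 2) atTop (𝓝 1) := by
    intro i
    have h1 : Tendsto (fun n => 1 - ‖ψ n i - V.starProjection (ψ n i)‖ ^ 2) atTop (𝓝 1) := by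
      simpa using ((hres i).norm.pow 2).const_sub 1
    refine h1.congr' ?_
    filter_upwards [ho] with n hn
    have h2 := V.norm_sq_eq_add_norm_sq_starProjection (ψ n i)
    have h3 := V.starProjection_orthogonal_val (ψ n i)
    rw [h3, hn.1 i] at h2
    linarith
  set b := stdOrthonormalBasis ℂ V
  -- Sum `|⟨ψ_i, b_l⟩|²` over both indices. Summing over `l` first gives `∑ ‖P ψ_i‖²`, which tends
  -- to the number of `ψ_i`; summing over `i` first measures how far the `b_l` are from the span. As
  -- there are equally many `ψ_i` and `b_l`, closeness of the `ψ_i` to `V` yields closeness of `V`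
  -- to their span.
  have hb : ∀ j, Tendsto (fun n => S n (b j : E)) atTop (𝓝 (b j : E)) := by
    intro j
    have hlim : Tendsto (fun n => (Fintype.card ι : ℝ) - ∑ i, ‖V.starProjection (ψ n i)‖ ^ 2)
        atTop (𝓝 0) := by
      have := (tendsto_finsetSum Finset.univ fun i _ => hnorm i).const_sub (Fintype.card ι : ℝ)
      simpa using this
    have hsq : Tendsto (fun n => ‖(b j : E) - S n (b j : E)‖ ^ 2) atTop (𝓝 0) := by
      refine squeeze_zero' (Eventually.of_forall fun n => sq_nonneg _) ?_ hlim
      filter_upwards [ho] with n hn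
      have hproj : ∀ i, ‖V.starProjection (ψ n i)‖ ^ 2 =
          ∑ l, ‖inner ℂ (ψ n i) (b l : E)‖ ^ 2 := by
        intro i
        have h1 := b.sum_sq_norm_inner_left (V.orthogonalProjectionOnto (ψ n i))
        rw [Submodule.starProjection_apply, ← Submodule.coe_norm, ← h1]
        refine Finset.sum_congr rfl fun l _ => ?_
        rw [Submodule.inner_orthogonalProjectionOnto_eq_of_mem_right]
      calc ‖(b j : E) - S n (b j : E)‖ ^ 2
          ≤ ∑ l, ‖(b l : E) - S n (b l : E)‖ ^ 2 :=
            Finset.single_le_sum (f := fun l => ‖(b l : E) - S n (b l : E)‖ ^ 2)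
              (fun l _ => sq_nonneg _) (Finset.mem_univ j)
        _ = ∑ l, (1 - ∑ i, ‖inner ℂ (ψ n i) (b l : E)‖ ^ 2) := by
            refine Finset.sum_congr rfl fun l _ => ?_
            have h1 : ‖(b l : E)‖ = 1 := b.orthonormal.1 l
            rw [hSv, hn.norm_sub_sum_sq, h1, one_pow]
        _ = (Fintype.card ι : ℝ) - ∑ i, ‖V.starProjection (ψ n i)‖ ^ 2 := by
            rw [Finset.sum_sub_distrib, Finset.sum_comm, hcard]
            simp only [hproj]
            simp
    have h0 : Tendsto (fun n => ‖S n (b j : E) - (b j : E)‖) atTop (𝓝 0) := by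
      have := hsq.sqrt
      simpa [Real.sqrt_sq, norm_sub_rev] using this
    exact tendsto_iff_norm_sub_tendsto_zero.2 h0
  have hmem : Tendsto (fun n => S n (V.starProjection g₀)) atTop (𝓝 (V.starProjection g₀)) := by
    have hrep : V.starProjection g₀ =
        ∑ j, inner ℂ (b j) (V.orthogonalProjectionOnto g₀) • (b j : E) := by
      have := congrArg Subtype.val (b.sum_repr' (V.orthogonalProjectionOnto g₀))
      rw [Submodule.starProjection_apply, ← this]
      simp
    rw [hrep]
    simp only [map_sum, map_smul]
    exact tendsto_finsetSum _ fun j _ => (hb j).const_smul _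
  -- A vector orthogonal to `V` pairs only with the vanishing part `ψ_i - P ψ_i`.
  have hperp : Tendsto (fun n => S n (g₀ - V.starProjection g₀)) atTop (𝓝 0) := by
    set v := g₀ - V.starProjection g₀ with hv
    have hvV : v ∈ Vᗮ := V.sub_starProjection_mem_orthogonal g₀
    have hlim : Tendsto (fun n => ∑ i, ‖ψ n i - V.starProjection (ψ n i)‖ * ‖v‖) atTop (𝓝 0) := by
      simpa using tendsto_finsetSum Finset.univ fun i _ => (hres i).norm.mul_const ‖v‖
    refine squeeze_zero_norm' ?_ hlim
    filter_upwards [ho] with n hn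
    rw [hSv]
    refine (norm_sum_le _ _).trans (Finset.sum_le_sum fun i _ => ?_)
    rw [norm_smul, hn.1 i, mul_one]
    have : inner ℂ (ψ n i) v = inner ℂ (ψ n i - V.starProjection (ψ n i)) v := by
      rw [inner_sub_left, (Submodule.mem_orthogonal V v).1 hvV _ (V.starProjection_apply_mem _),
        sub_zero]
    rw [this]
    exact norm_inner_le_norm _ _
  have hvar : Tendsto (fun n => S n (g n - g₀)) atTop (𝓝 0) := by
    have hlim : Tendsto (fun n => ∑ _i : ι, ‖g n - g₀‖) atTop (𝓝 0) := by
      simpa using tendsto_finsetSum Finset.univ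
        fun (_ : ι) _ => tendsto_iff_norm_sub_tendsto_zero.1 hg
    refine squeeze_zero_norm' ?_ hlim
    filter_upwards [ho] with n hn
    rw [hSv]
    refine (norm_sum_le _ _).trans (Finset.sum_le_sum fun i _ => ?_)
    rw [norm_smul, hn.1 i, mul_one]
    exact (norm_inner_le_norm _ _).trans (by rw [hn.1 i, one_mul])
  have := (hmem.add hperp).add hvar
  simp only [add_zero] at this
  refine this.congr fun n => ?_
  rw [← map_add, ← map_add, ← hSv]
  congr 1
  abel

end Perturbation

/-! ### The cut norm controls the operator norm -/

section CutNorm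

variable {X : Type*} [MeasurableSpace X] {μ : Measure X}

/-- Test on the sets where `a ≥ 0` and where `a ≤ 0`, whence the factor 2. These are only null
measurable, hence the passage to measurable supersets. -/
theorem integral_abs_le_of_setIntegral_le {a : X → ℝ} (ha : Integrable a μ) {c : ℝ}
    (h : ∀ S, MeasurableSet S → |∫ x in S, a x ∂μ| ≤ c) : ∫ x, |a x| ∂μ ≤ 2 * c := by
  have hnull : ∀ S, NullMeasurableSet S μ → |∫ x in S, a x ∂μ| ≤ c := by
    intro S hS
    obtain ⟨S', -, hS', hae⟩ := hS.exists_measurable_superset_ae_eq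
    rw [← setIntegral_congr_set hae]
    exact h S' hS'
  have h1 := integral_norm_eq_pos_sub_neg ha
  simp only [Real.norm_eq_abs] at h1
  rw [h1]
  have h2 := abs_le.1 (hnull {x | 0 ≤ a x} (nullMeasurableSet_le aemeasurable_const ha.aemeasurable))
  have h3 := abs_le.1 (hnull {x | a x ≤ 0} (nullMeasurableSet_le ha.aemeasurable aemeasurable_const))
  linarith [h2.2, h3.1]

theorem integral_norm_le_of_setIntegral_le {F : X → ℂ} (hF : Integrable F μ) {c : ℝ}
    (h : ∀ S, MeasurableSet S → ‖∫ x in S, F x ∂μ‖ ≤ c) : ∫ x, ‖F x‖ ∂μ ≤ 4 * c := by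
  have hre : ∫ x, |(F x).re| ∂μ ≤ 2 * c := by
    refine integral_abs_le_of_setIntegral_le hF.re fun S hS => ?_
    have : ∫ x in S, (F x).re ∂μ = (∫ x in S, F x ∂μ).re := integral_re hF.integrableOn
    refine (congrArg abs this).trans_le ?_
    exact (Complex.abs_re_le_norm _).trans (h S hS)
  have him : ∫ x, |(F x).im| ∂μ ≤ 2 * c := by
    refine integral_abs_le_of_setIntegral_le hF.im fun S hS => ?_
    have : ∫ x in S, (F x).im ∂μ = (∫ x in S, F x ∂μ).im := integral_im hF.integrableOn
    refine (congrArg abs this).trans_le ?_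
    exact (Complex.abs_im_le_norm _).trans (h S hS)
  have hsum : ∫ x, ‖F x‖ ∂μ ≤ ∫ x, |(F x).re| ∂μ + ∫ x, |(F x).im| ∂μ := by
    refine (integral_mono hF.norm (hF.re.abs.add hF.im.abs)
      fun x => Complex.norm_le_abs_re_add_abs_im _).trans_eq ?_
    exact integral_add hF.re.abs hF.im.abs
  linarith

variable {u : X → X → ℝ}

theorem norm_kernel_apply_le (hb : ∀ x y, |u x y| ≤ 1) {ξ : X → ℂ} (hξ : Integrable ξ μ) (x : X) :
    ‖∫ y, (u x y : ℂ) * ξ y ∂μ‖ ≤ ∫ y, ‖ξ y‖ ∂μ := by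
  refine norm_integral_le_of_norm_le hξ.norm (Eventually.of_forall fun y => ?_)
  rw [norm_mul, Complex.norm_real, Real.norm_eq_abs]
  exact mul_le_of_le_one_left (norm_nonneg _) (hb x y)

theorem Lp.integrable_sq_norm (ξ : Lp ℂ 2 μ) : Integrable (fun x => ‖ξ x‖ ^ 2) μ :=
  (Lp.memLp ξ).integrable_norm_pow (by norm_num)

theorem Lp.sq_norm_eq_integral (ξ : Lp ℂ 2 μ) : ‖ξ‖ ^ 2 = ∫ x, ‖ξ x‖ ^ 2 ∂μ := by
  have h := L2.inner_def (𝕜 := ℂ) ξ ξ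
  rw [inner_self_eq_norm_sq_to_K] at h
  have h2 : (∫ x, inner ℂ (ξ x) (ξ x) ∂μ) = ((∫ x, ‖ξ x‖ ^ 2 ∂μ : ℝ) : ℂ) := by
    refine Eq.trans ?_ (integral_ofReal (𝕜 := ℂ) (f := fun x => ‖ξ x‖ ^ 2))
    refine integral_congr_ae (Eventually.of_forall fun x => ?_)
    simp only [inner_self_eq_norm_sq_to_K]
    norm_cast
  rw [h2] at h
  exact Complex.ofReal_injective (by rw [← h]; norm_cast)

variable [IsProbabilityMeasure μ]

theorem integrable_uncurry_of_abs_le_one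
    (hu : AEMeasurable (Function.uncurry u) (μ.prod μ)) (hb : ∀ x y, |u x y| ≤ 1) :
    Integrable (Function.uncurry u) (μ.prod μ) :=
  Integrable.of_bound hu.aestronglyMeasurable 1 (Eventually.of_forall fun p => hb p.1 p.2)

theorem abs_setIntegral_prod_le_cutNorm (hb : ∀ x y, |u x y| ≤ 1)
    {S T : Set X} (hS : MeasurableSet S) (hT : MeasurableSet T) :
    |∫ p in S ×ˢ T, u p.1 p.2 ∂(μ.prod μ)| ≤ cutNorm μ u := by
  have hbdd : BddAbove (Set.range fun ST : {S : Set X // MeasurableSet S} ×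
      {T : Set X // MeasurableSet T} =>
        |∫ p in (ST.1 : Set X) ×ˢ (ST.2 : Set X), u p.1 p.2 ∂(μ.prod μ)|) := by
    refine ⟨1, ?_⟩
    rintro _ ⟨ST, rfl⟩
    refine (norm_setIntegral_le_of_norm_le_const (f := fun p : X × X => u p.1 p.2) (C := 1)
      (measure_lt_top _ _) fun p _ => hb p.1 p.2).trans ?_
    rw [one_mul]
    exact measureReal_le_one
  exact le_ciSup hbdd (⟨S, hS⟩, ⟨T, hT⟩)

theorem integrable_kernel_mul
    (hu : AEMeasurable (Function.uncurry u) (μ.prod μ)) (hb : ∀ x y, |u x y| ≤ 1)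
    {ξ : X → ℂ} (hξ : Integrable ξ μ) :
    Integrable (fun p : X × X => (u p.1 p.2 : ℂ) * ξ p.2) (μ.prod μ) := by
  refine (hξ.comp_snd μ).bdd_mul (c := 1)
    (Complex.measurable_ofReal.comp_aemeasurable hu).aestronglyMeasurable
    (Eventually.of_forall fun p => ?_)
  rw [Complex.norm_real]
  exact hb p.1 p.2

/-- For fixed `S`, the function `a y = ∫_S u(x, y) dx` has `L¹` norm at most twice the cut norm, so
pairing it with `ξ` costs `2M`. Passing from sets `S` to the `L¹` norm of a complex function costs
another 4. -/
theorem integral_norm_kernel_le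
    (hu : AEMeasurable (Function.uncurry u) (μ.prod μ)) (hb : ∀ x y, |u x y| ≤ 1)
    {ξ : X → ℂ} (hξ : Integrable ξ μ) {M : ℝ} (hM : 0 ≤ M) (hξM : ∀ x, ‖ξ x‖ ≤ M) :
    ∫ x, ‖∫ y, (u x y : ℂ) * ξ y ∂μ‖ ∂μ ≤ 8 * M * cutNorm μ u := by
  have hint := integrable_kernel_mul hu hb hξ
  have hu1 := integrable_uncurry_of_abs_le_one hu hb
  have key : ∀ S, MeasurableSet S →
      ‖∫ x in S, ∫ y, (u x y : ℂ) * ξ y ∂μ ∂μ‖ ≤ 2 * M * cutNorm μ u := by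
    intro S hS
    have hres : ∀ {β : Type} [NormedAddCommGroup β] {f : X × X → β}, Integrable f (μ.prod μ) →
        Integrable f ((μ.restrict S).prod μ) := fun hf => by
      have h := hf.integrableOn (s := S ×ˢ Set.univ)
      rwa [IntegrableOn, ← Measure.prod_restrict, Measure.restrict_univ] at h
    set a : X → ℝ := fun y => ∫ x in S, u x y ∂μ with ha
    have haint : Integrable a μ := (hres hu1).integral_prod_right
    have ha2 : ∫ y, |a y| ∂μ ≤ 2 * cutNorm μ u := by
      refine integral_abs_le_of_setIntegral_le haint fun T hT => ?_
      have : ∫ y in T, a y ∂μ = ∫ p in S ×ˢ T, u p.1 p.2 ∂(μ.prod μ) := by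
        rw [← Measure.prod_restrict, integral_prod_symm]
        rw [Measure.prod_restrict]
        exact hu1.integrableOn
      rw [this]
      exact abs_setIntegral_prod_le_cutNorm hb hS hT
    have hswap : ∫ x in S, ∫ y, (u x y : ℂ) * ξ y ∂μ ∂μ = ∫ y, (a y : ℂ) * ξ y ∂μ := by
      rw [integral_integral_swap (f := fun x y => (u x y : ℂ) * ξ y) (hres hint)]
      refine integral_congr_ae (Eventually.of_forall fun y => ?_)
      simp only [ha]
      rw [integral_mul_const]
      exact congrArg (· * ξ y) integral_ofReal
    rw [hswap]
    have h1 : ‖∫ y, (a y : ℂ) * ξ y ∂μ‖ ≤ ∫ y, |a y| * M ∂μ := by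
      refine norm_integral_le_of_norm_le (haint.abs.mul_const M) (Eventually.of_forall fun y => ?_)
      rw [norm_mul, Complex.norm_real, Real.norm_eq_abs]
      exact mul_le_mul_of_nonneg_left (hξM y) (abs_nonneg _)
    rw [integral_mul_const] at h1
    nlinarith
  have := integral_norm_le_of_setIntegral_le hint.integral_prod_left key
  linarith

theorem Lp.integrable_of_two (ξ : Lp ℂ 2 μ) : Integrable ξ μ :=
  (Lp.memLp ξ).integrable (by norm_num)

theorem Lp.integral_norm_le (ξ : Lp ℂ 2 μ) : ∫ x, ‖ξ x‖ ∂μ ≤ ‖ξ‖ := by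
  rw [integral_norm_eq_lintegral_enorm (Lp.aestronglyMeasurable ξ), Lp.norm_def,
    ← eLpNorm_one_eq_lintegral_enorm]
  exact ENNReal.toReal_mono (Lp.eLpNorm_ne_top ξ)
    (eLpNorm_le_eLpNorm_of_exponent_le (by norm_num) (Lp.aestronglyMeasurable ξ))

/-- Truncate `ξ` at height `M`. The bounded part is controlled by the cut norm; on the rest `|ξ| ≤
|ξ|² / M`, so its `L¹` norm is at most `1 / M`. -/
theorem integral_norm_kernel_le_of_norm_le_one
    (hu : AEMeasurable (Function.uncurry u) (μ.prod μ)) (hb : ∀ x y, |u x y| ≤ 1)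
    (ξ : Lp ℂ 2 μ) (hξ1 : ‖ξ‖ ≤ 1) {M : ℝ} (hM : 0 < M) :
    ∫ x, ‖∫ y, (u x y : ℂ) * ξ y ∂μ‖ ∂μ ≤ 8 * M * cutNorm μ u + 1 / M := by
  have hξ := Lp.integrable_of_two ξ
  have hS : NullMeasurableSet {y | ‖ξ y‖ ≤ M} μ :=
    nullMeasurableSet_le hξ.norm.aemeasurable aemeasurable_const
  set S := {y | ‖ξ y‖ ≤ M} with hSdef
  set ξ₁ : X → ℂ := S.indicator ξ
  set ξ₂ : X → ℂ := Sᶜ.indicator ξ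
  have h1 : Integrable ξ₁ μ := hξ.indicator₀ hS
  have h2 : Integrable ξ₂ μ := hξ.indicator₀ hS.compl
  have hb1 : ∀ y, ‖ξ₁ y‖ ≤ M := fun y => by
    by_cases hy : y ∈ S
    · rw [show ξ₁ y = ξ y from Set.indicator_of_mem hy _]
      exact hy
    · simp [ξ₁, hy, hM.le]
  have hb2 : ∀ y, ‖ξ₂ y‖ ≤ ‖ξ y‖ ^ 2 / M := fun y => by
    by_cases hy : y ∈ S
    · simp only [ξ₂, Set.indicator_of_notMem (Set.notMem_compl_iff.2 hy), norm_zero]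
      positivity
    · have hy' : M < ‖ξ y‖ := not_le.1 hy
      simp only [ξ₂, Set.indicator_of_mem (Set.mem_compl hy)]
      rw [le_div_iff₀ hM]
      nlinarith [norm_nonneg (ξ y)]
  have hi2 : ∫ y, ‖ξ₂ y‖ ∂μ ≤ 1 / M := by
    refine (integral_mono h2.norm ((Lp.integrable_sq_norm ξ).div_const M) hb2).trans ?_
    rw [integral_div, ← Lp.sq_norm_eq_integral]
    gcongr
    nlinarith [norm_nonneg ξ]
  have hsplit : ∀ᵐ x ∂μ, ‖∫ y, (u x y : ℂ) * ξ y ∂μ‖ ≤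
      ‖∫ y, (u x y : ℂ) * ξ₁ y ∂μ‖ + ‖∫ y, (u x y : ℂ) * ξ₂ y ∂μ‖ := by
    filter_upwards [(integrable_kernel_mul hu hb h1).prod_right_ae,
      (integrable_kernel_mul hu hb h2).prod_right_ae] with x hx1 hx2
    have : ∫ y, (u x y : ℂ) * ξ y ∂μ =
        ∫ y, (u x y : ℂ) * ξ₁ y ∂μ + ∫ y, (u x y : ℂ) * ξ₂ y ∂μ := by
      rw [← integral_add hx1 hx2]
      refine integral_congr_ae (Eventually.of_forall fun y => ?_)
      simp only
      rw [← mul_add, ← Pi.add_apply ξ₁ ξ₂, Set.indicator_self_add_compl]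
    rw [this]
    exact norm_add_le _ _
  have hK := (integrable_kernel_mul hu hb hξ).integral_prod_left
  have hK1 := (integrable_kernel_mul hu hb h1).integral_prod_left
  have hK2 := (integrable_kernel_mul hu hb h2).integral_prod_left
  have h3 := integral_mono_ae hK.norm (hK1.norm.add hK2.norm) hsplit
  simp only [Pi.add_apply] at h3
  rw [integral_add hK1.norm hK2.norm] at h3
  refine h3.trans (add_le_add (integral_norm_kernel_le hu hb h1 hM.le hb1) ?_)
  have h4 : ∫ x, ‖∫ y, (u x y : ℂ) * ξ₂ y ∂μ‖ ∂μ ≤ ∫ _x, 1 / M ∂μ :=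
    integral_mono hK2.norm (integrable_const _) fun x => (norm_kernel_apply_le hb h2 x).trans hi2
  simpa using h4

theorem Graphon.op_apply_ae (w : Graphon μ) (ξ : Lp ℂ 2 μ) :
    w.op ξ =ᵐ[μ] fun x => ∫ y, (w.toFun x y : ℂ) * ξ y ∂μ :=
  (w.memLp_integral ξ).coeFn_toLp

/-- For a unit vector `ξ` the image under the difference is pointwise at most 1, so its squared `L²`
norm is at most its `L¹` norm; this is the source of the square root. -/
theorem Graphon.norm_op_sub_op_le (w w' : Graphon μ) {M : ℝ} (hM : 0 < M) :
    ‖w.op - w'.op‖ ≤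
      √(8 * M * cutNorm μ (fun x y => w.toFun x y - w'.toFun x y) + 1 / M) := by
  set u : X → X → ℝ := fun x y => w.toFun x y - w'.toFun x y with hudef
  have hu : AEMeasurable (Function.uncurry u) (μ.prod μ) := w.aemeasurable'.sub w'.aemeasurable'
  have hb : ∀ x y, |u x y| ≤ 1 := fun x y => by
    have h1 := w.mem_Icc' x y
    have h2 := w'.mem_Icc' x y
    exact abs_le.2 ⟨by linarith [h1.1, h2.2], by linarith [h1.2, h2.1]⟩
  refine ContinuousLinearMap.opNorm_le_of_unit_norm (Real.sqrt_nonneg _) fun ξ hξ => ?_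
  refine Real.le_sqrt_of_sq_le ?_
  refine le_trans ?_ (integral_norm_kernel_le_of_norm_le_one hu hb ξ hξ.le hM)
  have hint := Lp.integrable_of_two ξ
  rw [Lp.sq_norm_eq_integral]
  refine integral_mono_ae (Lp.integrable_sq_norm _)
    (integrable_kernel_mul hu hb hint).integral_prod_left.norm ?_
  filter_upwards [Lp.coeFn_sub (w.op ξ) (w'.op ξ), w.op_apply_ae ξ, w'.op_apply_ae ξ,
    w.integrable_mul ξ, w'.integrable_mul ξ] with x h1 h2 h3 h4 h5
  have h6 : ((w.op - w'.op) ξ : Lp ℂ 2 μ) x = ∫ y, (u x y : ℂ) * ξ y ∂μ := by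
    rw [sub_apply, h1, Pi.sub_apply, h2, h3, ← integral_sub h4 h5]
    refine integral_congr_ae (Eventually.of_forall fun y => ?_)
    simp only [hudef, Complex.ofReal_sub, sub_mul]
  rw [h6]
  have h7 : ‖∫ y, (u x y : ℂ) * ξ y ∂μ‖ ≤ 1 :=
    (norm_kernel_apply_le hb hint x).trans ((Lp.integral_norm_le ξ).trans hξ.le)
  nlinarith [norm_nonneg (∫ y, (u x y : ℂ) * ξ y ∂μ)]

theorem Graphon.tendsto_op {w : Graphon μ} {wn : ℕ → Graphon μ}
    (h : Tendsto (fun n => cutNorm μ (fun x y => (wn n).toFun x y - w.toFun x y)) atTop (𝓝 0)) :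
    Tendsto (fun n => (wn n).op) atTop (𝓝 w.op) := by
  refine Metric.tendsto_nhds.2 fun ε hε => ?_
  -- `M` is fixed before `n` grows; this choice makes `√(1 / M) = ε / 2`.
  obtain ⟨M, hM, hMε⟩ : ∃ M : ℝ, 0 < M ∧ √(1 / M) < ε := by
    refine ⟨4 / ε ^ 2, by positivity, (Real.sqrt_lt' hε).2 ?_⟩
    rw [one_div_div]
    nlinarith [sq_pos_of_pos hε]
  have hlim := (((h.const_mul (8 * M)).add_const (1 / M)).sqrt)
  rw [mul_zero, zero_add] at hlim
  filter_upwards [hlim.eventually_lt_const hMε] with n hn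
  rw [dist_eq_norm]
  exact ((wn n).norm_op_sub_op_le w hM).trans_lt hn

end CutNorm

/-! ### The operator of the graphon of a graph is a lift of the graph shift -/

section Lift

theorem eq_of_mem_cell {N : ℕ} {i j : Fin N} {t : unitInterval} (hi : t ∈ cell N i)
    (hj : t ∈ cell N j) : i = j := by
  have hN : (0 : ℝ) < N := Nat.cast_pos.2 i.pos
  obtain ⟨h1, h2⟩ := hi
  obtain ⟨h3, h4⟩ := hj
  have h5 := (div_lt_div_iff_of_pos_right hN).1 (h1.trans_lt h4)
  have h6 := (div_lt_div_iff_of_pos_right hN).1 (h3.trans_lt h2)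
  norm_cast at h5 h6
  exact Fin.ext (by omega)

theorem volume_cell (N : ℕ) (k : Fin N) : volume (cell N k) = ENNReal.ofReal ((N : ℝ)⁻¹) := by
  have hN : (0 : ℝ) < N := Nat.cast_pos.2 k.pos
  have hk : ((k : ℕ) : ℝ) + 1 ≤ N := by exact_mod_cast k.isLt
  have himage : (Subtype.val '' cell N k : Set ℝ) =
      Set.Ico (((k : ℕ) : ℝ) / N) ((((k : ℕ) : ℝ) + 1) / N) := by
    ext x
    constructor
    · rintro ⟨t, ht, rfl⟩
      exact ht
    · intro hx
      refine ⟨⟨x, le_trans (by positivity) hx.1, hx.2.le.trans ?_⟩, hx, rfl⟩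
      rwa [div_le_one hN]
  rw [Measure.Subtype.volume_def, comap_subtype_coe_apply measurableSet_Icc, himage,
    Real.volume_Ico]
  congr 1
  field_simp
  ring

theorem sum_indicator_cell_of_mem {β : Type*} [AddCommMonoid β] {N : ℕ} {i : Fin N}
    {t : unitInterval} (hi : t ∈ cell N i) (c : Fin N → β) :
    ∑ k, (cell N k).indicator (fun _ => c k) t = c i := by
  rw [Finset.sum_eq_single i (fun k _ hk => Set.indicator_of_notMem
    (fun h => hk (eq_of_mem_cell h hi)) _) (fun h => absurd (Finset.mem_univ i) h),
    Set.indicator_of_mem hi]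

theorem sum_indicator_cell_of_forall_notMem {β : Type*} [AddCommMonoid β] {N : ℕ}
    {t : unitInterval} (h : ∀ i, t ∉ cell N i) (c : Fin N → β) :
    ∑ k, (cell N k).indicator (fun _ => c k) t = 0 :=
  Finset.sum_eq_zero fun k _ => Set.indicator_of_notMem (h k) _

theorem norm_stepSignal_sq {N : ℕ} (f : EuclideanSpace ℂ (Fin N)) (t : unitInterval) :
    ‖stepSignal f t‖ ^ 2 = ∑ k, (cell N k).indicator (fun _ => (N : ℝ) * ‖f k‖ ^ 2) t := by
  rw [stepSignal]
  by_cases h : ∃ i, t ∈ cell N i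
  · obtain ⟨i, hi⟩ := h
    rw [sum_indicator_cell_of_mem hi, sum_indicator_cell_of_mem hi, norm_mul, mul_pow,
      Complex.norm_real, Real.norm_eq_abs, sq_abs, Real.sq_sqrt (Nat.cast_nonneg N)]
  · push Not at h
    rw [sum_indicator_cell_of_forall_notMem h, sum_indicator_cell_of_forall_notMem h]
    simp

open scoped Classical in
-- The cells are disjoint but half-open: the endpoint `1` lies in none of them, and there both sides
-- vanish.
theorem graphKernel_eq_sum {N : ℕ} (G : SimpleGraph (Fin N)) (s t : unitInterval) :
    (graphKernel G s t : ℂ) = ∑ i, (cell N i).indicator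
      (fun _ => ∑ j, (cell N j).indicator (fun _ => G.adjMatrix ℂ i j) t) s := by
  rw [graphKernel]
  by_cases hs : ∃ i, s ∈ cell N i
  · obtain ⟨i, hi⟩ := hs
    rw [sum_indicator_cell_of_mem hi]
    by_cases ht : ∃ j, t ∈ cell N j
    · obtain ⟨j, hj⟩ := ht
      rw [sum_indicator_cell_of_mem hj, SimpleGraph.adjMatrix_apply]
      have : (∃ i j, G.Adj i j ∧ s ∈ cell N i ∧ t ∈ cell N j) ↔ G.Adj i j := by
        constructor
        · rintro ⟨i', j', h, hi', hj'⟩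
          rwa [eq_of_mem_cell hi hi', eq_of_mem_cell hj hj']
        · exact fun h => ⟨i, j, h, hi, hj⟩
      simp only [this]
      split_ifs <;> simp
    · push Not at ht
      rw [sum_indicator_cell_of_forall_notMem ht, if_neg, Complex.ofReal_zero]
      rintro ⟨-, j, -, -, hj⟩
      exact ht j hj
  · push Not at hs
    rw [sum_indicator_cell_of_forall_notMem hs, if_neg, Complex.ofReal_zero]
    rintro ⟨i, -, -, hi, -⟩
    exact hs i hi

variable {X : Type*} [MeasurableSpace X] {μ : Measure X} (σ : IsoModZero μ)

theorem IsoModZero.nullMeasurableSet_preimage_cell {N : ℕ} (k : Fin N) :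
    NullMeasurableSet (σ.invFun ⁻¹' cell N k) μ :=
  σ.nullMeasurable_invFun (measurableSet_cell N k)

variable [IsProbabilityMeasure μ]

theorem liftSignal_ae {N : ℕ} (f : EuclideanSpace ℂ (Fin N)) :
    liftSignal σ f =ᵐ[μ] fun x => stepSignal f (σ.invFun x) :=
  MemLp.coeFn_toLp _

/-- The factor `√N` in the step function offsets the mass `1 / N` of a cell. -/
theorem norm_liftSignal {N : ℕ} (f : EuclideanSpace ℂ (Fin N)) : ‖liftSignal σ f‖ = ‖f‖ := by
  refine (pow_left_inj₀ (norm_nonneg _) (norm_nonneg _) two_ne_zero).1 ?_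
  rw [Lp.sq_norm_eq_integral, EuclideanSpace.norm_sq_eq]
  have h1 : ∫ x, ‖liftSignal σ f x‖ ^ 2 ∂μ =
      ∫ x, ∑ k, (σ.invFun ⁻¹' cell N k).indicator (fun _ => (N : ℝ) * ‖f k‖ ^ 2) x ∂μ := by
    refine integral_congr_ae ?_
    filter_upwards [liftSignal_ae σ f] with x hx
    rw [hx, norm_stepSignal_sq]
    rfl
  rw [h1, integral_finsetSum]
  · refine Finset.sum_congr rfl fun k _ => ?_
    have hN : (0 : ℝ) < N := Nat.cast_pos.2 k.pos
    rw [integral_indicator₀ (σ.nullMeasurableSet_preimage_cell k), setIntegral_const,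
      Measure.real, σ.measure_invFun _ (measurableSet_cell N k), volume_cell,
      ENNReal.toReal_ofReal (by positivity), smul_eq_mul, inv_mul_cancel_left₀ hN.ne']
  · exact fun k _ => (integrable_const _).indicator₀ (σ.nullMeasurableSet_preimage_cell k)

/-- The lift of graph signals to `L²(X)` as a linear isometry. -/
def liftIsometry (N : ℕ) : EuclideanSpace ℂ (Fin N) →ₗᵢ[ℂ] Lp ℂ 2 μ where
  toFun := liftSignal σ
  map_add' f g := by
    refine Lp.ext ?_
    filter_upwards [liftSignal_ae σ f, liftSignal_ae σ g, liftSignal_ae σ (f + g),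
      Lp.coeFn_add (liftSignal σ f) (liftSignal σ g)] with x h1 h2 h3 h4
    rw [h3, h4, Pi.add_apply, h1, h2, stepSignal, stepSignal, stepSignal, ← mul_add,
      ← Finset.sum_add_distrib]
    exact congrArg _ (Finset.sum_congr rfl fun k _ => congrFun
      (Set.indicator_add (cell N k) (fun _ => f k) (fun _ => g k)) _)
  map_smul' c f := by
    refine Lp.ext ?_
    filter_upwards [liftSignal_ae σ f, liftSignal_ae σ (c • f),
      Lp.coeFn_smul c (liftSignal σ f)] with x h1 h2 h3
    rw [RingHom.id_apply, h2, h3, Pi.smul_apply, h1, stepSignal, stepSignal, smul_eq_mul,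
      mul_left_comm, Finset.mul_sum (a := c)]
    exact congrArg _ (Finset.sum_congr rfl fun k _ =>
      Set.indicator_const_mul (cell N k) (fun _ => f k) c _)
  norm_map' := norm_liftSignal σ

theorem liftIsometry_apply {N : ℕ} (f : EuclideanSpace ℂ (Fin N)) :
    liftIsometry σ N f = liftSignal σ f := rfl

theorem adjoint_liftIsometry_apply {N : ℕ} (ξ : Lp ℂ 2 μ) (k : Fin N) :
    ContinuousLinearMap.adjoint (liftIsometry σ N).toContinuousLinearMap ξ k =
      ((√(N : ℝ) : ℝ) : ℂ) * ∫ x in σ.invFun ⁻¹' cell N k, ξ x ∂μ := by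
  have h1 := EuclideanSpace.inner_single_left (𝕜 := ℂ) k 1
    (ContinuousLinearMap.adjoint (liftIsometry σ N).toContinuousLinearMap ξ)
  rw [map_one, one_mul, ContinuousLinearMap.adjoint_inner_right] at h1
  rw [← h1, ← integral_indicator₀ (σ.nullMeasurableSet_preimage_cell k), ← integral_const_mul]
  refine (L2.inner_def _ _).trans (integral_congr_ae ?_)
  filter_upwards [liftSignal_ae σ (EuclideanSpace.single k (1 : ℂ))] with x hx
  have hx' : ((liftIsometry σ N).toContinuousLinearMap (EuclideanSpace.single k 1) : Lp ℂ 2 μ) x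
      = stepSignal (EuclideanSpace.single k 1) (σ.invFun x) := hx
  have hstep : stepSignal (EuclideanSpace.single k 1) (σ.invFun x) =
      ((√(N : ℝ) : ℝ) : ℂ) * (σ.invFun ⁻¹' cell N k).indicator (fun _ => 1) x := by
    rw [stepSignal, Finset.sum_eq_single k]
    · simp [Set.indicator]
      rfl
    · intro j _ hj
      simp [Set.indicator, hj]
    · simp
  rw [hx', hstep]
  by_cases hxk : x ∈ σ.invFun ⁻¹' cell N k <;> simp [hxk, mul_comm]

/-- The graph shift as a continuous operator. -/
abbrev graphShiftL {N : ℕ} (G : SimpleGraph (Fin N)) :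
    EuclideanSpace ℂ (Fin N) →L[ℂ] EuclideanSpace ℂ (Fin N) :=
  LinearMap.toContinuousLinearMap (graphShift G)

theorem isSymmetric_graphShift {N : ℕ} (G : SimpleGraph (Fin N)) : (graphShift G).IsSymmetric := by
  rw [graphShift, Matrix.isSymmetric_toEuclideanLin_iff, normAdjMatrix, Matrix.IsHermitian,
    Matrix.conjTranspose_smul]
  congr 1
  · simp
  · ext i j
    have hij := G.adj_comm j i
    by_cases h : G.Adj i j <;> simp [SimpleGraph.adjMatrix_apply, h, hij]

theorem isCompactOperator_graphShiftL {N : ℕ} (G : SimpleGraph (Fin N)) :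
    IsCompactOperator (graphShiftL G) :=
  isCompactOperator_of_locallyCompactSpace_dom (graphShiftL G)

open scoped Classical in
theorem graphShift_apply {N : ℕ} (G : SimpleGraph (Fin N)) (v : EuclideanSpace ℂ (Fin N))
    (i : Fin N) : graphShift G v i = (N : ℂ)⁻¹ * ∑ j, G.adjMatrix ℂ i j * v j := by
  rw [graphShift, Matrix.toLpLin_apply, normAdjMatrix, Matrix.smul_mulVec]
  rfl

/-- A kernel constant on products of cells sees `ξ` only through its cell integrals, which the
adjoint records, and it returns a step function. The factors `√N` from lift and adjoint cancel the
`1 / N` of the normalized adjacency matrix. -/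
theorem op_graphGraphon_apply {N : ℕ} (G : SimpleGraph (Fin N)) (ξ : Lp ℂ 2 μ) :
    (graphGraphon σ G).op ξ = liftIsometry σ N (graphShiftL G
      (ContinuousLinearMap.adjoint (liftIsometry σ N).toContinuousLinearMap ξ)) := by
  classical
  refine Lp.ext ?_
  set v := ContinuousLinearMap.adjoint (liftIsometry σ N).toContinuousLinearMap ξ with hv
  filter_upwards [(graphGraphon σ G).op_apply_ae ξ, liftSignal_ae σ (graphShift G v)] with x h1 h2
  refine h1.trans (Eq.trans ?_ h2.symm)
  have hξ := Lp.integrable_of_two ξ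
  have hind : ∀ k : Fin N, Integrable ((σ.invFun ⁻¹' cell N k).indicator ξ) μ := fun k =>
    hξ.indicator₀ (σ.nullMeasurableSet_preimage_cell k)
  have hinner : ∀ (i : Fin N), ∫ y, ∑ j, G.adjMatrix ℂ i j *
      (σ.invFun ⁻¹' cell N j).indicator ξ y ∂μ =
        ∑ j, G.adjMatrix ℂ i j * ∫ y in σ.invFun ⁻¹' cell N j, ξ y ∂μ := fun i => by
    rw [integral_finsetSum _ fun j _ => (hind j).const_mul _]
    refine Finset.sum_congr rfl fun j _ => ?_
    rw [integral_const_mul, integral_indicator₀ (σ.nullMeasurableSet_preimage_cell j)]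
  have hker : ∀ y, ((graphGraphon σ G).toFun x y : ℂ) * ξ y = ∑ i, (cell N i).indicator
      (fun _ => ∑ j, G.adjMatrix ℂ i j * (σ.invFun ⁻¹' cell N j).indicator ξ y)
        (σ.invFun x) := fun y => by
    change (graphKernel G (σ.invFun x) (σ.invFun y) : ℂ) * ξ y = _
    rw [graphKernel_eq_sum, Finset.sum_mul]
    refine Finset.sum_congr rfl fun i _ => ?_
    rw [← Set.indicator_mul_const]
    congr 1
    funext _
    rw [Finset.sum_mul]
    refine Finset.sum_congr rfl fun j _ => ?_
    by_cases hy : σ.invFun y ∈ cell N j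
    · rw [Set.indicator_of_mem hy, Set.indicator_of_mem (show y ∈ σ.invFun ⁻¹' cell N j from hy)]
    · rw [Set.indicator_of_notMem hy,
        Set.indicator_of_notMem (show y ∉ σ.invFun ⁻¹' cell N j from hy), zero_mul, mul_zero]
  simp only [hker]
  rw [stepSignal]
  by_cases hx : ∃ i, σ.invFun x ∈ cell N i
  · obtain ⟨i, hi⟩ := hx
    have hN : (N : ℂ) ≠ 0 := Nat.cast_ne_zero.2 i.pos.ne'
    have hsq : ((√(N : ℝ) : ℝ) : ℂ) * ((√(N : ℝ) : ℝ) : ℂ) = N := by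
      rw [← Complex.ofReal_mul, Real.mul_self_sqrt (Nat.cast_nonneg N), Complex.ofReal_natCast]
    simp only [sum_indicator_cell_of_mem hi]
    rw [hinner, graphShift_apply, Finset.mul_sum, Finset.mul_sum]
    refine Finset.sum_congr rfl fun j _ => ?_
    rw [hv, adjoint_liftIsometry_apply]
    generalize ∫ y in σ.invFun ⁻¹' cell N j, ξ y ∂μ = z
    calc G.adjMatrix ℂ i j * z
        = (((√(N : ℝ) : ℝ) : ℂ) * ((√(N : ℝ) : ℝ) : ℂ)) * (N : ℂ)⁻¹ * (G.adjMatrix ℂ i j * z) := by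
          rw [hsq, mul_inv_cancel₀ hN, one_mul]
      _ = _ := by ring
  · push Not at hx
    simp only [sum_indicator_cell_of_forall_notMem hx]
    simp

theorem isCompactOperator_op_graphGraphon {N : ℕ} (G : SimpleGraph (Fin N)) :
    IsCompactOperator (graphGraphon σ G).op := by
  have h : ((graphGraphon σ G).op : Lp ℂ 2 μ → Lp ℂ 2 μ) =
      (liftIsometry σ N).toContinuousLinearMap ∘ (graphShiftL G ∘
        ContinuousLinearMap.adjoint (liftIsometry σ N).toContinuousLinearMap) :=
    funext fun ξ => op_graphGraphon_apply σ G ξ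
  rw [h]
  exact ((isCompactOperator_graphShiftL G).comp_clm _).clm_comp _

theorem isSymmetric_op_graphGraphon {N : ℕ} (G : SimpleGraph (Fin N)) (ξ η : Lp ℂ 2 μ) :
    inner ℂ ((graphGraphon σ G).op ξ) η = inner ℂ ξ ((graphGraphon σ G).op η) := by
  have h1 := ContinuousLinearMap.adjoint_inner_right (liftIsometry σ N).toContinuousLinearMap
  have h2 := ContinuousLinearMap.adjoint_inner_left (liftIsometry σ N).toContinuousLinearMap
  simp only [LinearIsometry.coe_toContinuousLinearMap] at h1 h2
  rw [op_graphGraphon_apply, op_graphGraphon_apply, ← h1, ← h2]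
  exact isSymmetric_graphShift G _ _

theorem op_graphGraphon_liftSignal {N : ℕ} (G : SimpleGraph (Fin N))
    (v : EuclideanSpace ℂ (Fin N)) :
    (graphGraphon σ G).op (liftSignal σ v) = liftSignal σ (graphShift G v) := by
  rw [op_graphGraphon_apply]
  have : ContinuousLinearMap.adjoint (liftIsometry σ N).toContinuousLinearMap (liftSignal σ v) = v :=
    DFunLike.congr_fun (liftIsometry σ N).adjoint_comp_self v
  rw [this]
  rfl

end Lift

/-! ### Convergence of the spectral data and of filtered signals -/

section Ordered

variable {E : Type*} [NormedAddCommGroup E] [InnerProductSpace ℂ E]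

theorem posEigenvalue_nonneg (T : Module.End ℂ E) (k : ℕ) : 0 ≤ posEigenvalue T k :=
  Real.sSup_nonneg fun _ h => h.1.le

theorem eigenspace_neg_neg (T : Module.End ℂ E) (ν : ℝ) :
    (-T).eigenspace ((-ν : ℝ) : ℂ) = T.eigenspace (ν : ℂ) := by
  ext v
  rw [Module.End.mem_eigenspace_iff, Module.End.mem_eigenspace_iff, LinearMap.neg_apply,
    Complex.ofReal_neg, neg_smul, neg_inj]

theorem isSymmetric_neg {T : E →L[ℂ] E} (hs : (T : Module.End ℂ E).IsSymmetric) :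
    ((-T : E →L[ℂ] E) : Module.End ℂ E).IsSymmetric := fun v w => by
  have h : inner ℂ (T v) w = inner ℂ v (T w) := hs v w
  change inner ℂ (-T v) w = inner ℂ v (-T w)
  rw [inner_neg_left, inner_neg_right, h]

variable [CompleteSpace E] {T : E →L[ℂ] E}

/-- A nonzero eigenvalue occurs in the ordered list as often as its multiplicity says. -/
theorem exists_finset_eigenvalueIndices (hc : IsCompactOperator T)
    (hs : (T : Module.End ℂ E).IsSymmetric) {ν : ℝ} (hν : ν ≠ 0) :
    ∃ I : Finset ℤ, (I : Set ℤ) = eigenvalueIndices (T : Module.End ℂ E) ν ∧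
      I.card = Module.finrank ℂ (Module.End.eigenspace (T : Module.End ℂ E) (ν : ℂ)) := by
  rcases hν.lt_or_gt with h | h
  -- A negative `ν` is the positive eigenvalue `-ν` of `-T`, with the same eigenspace.
  · have hc' : IsCompactOperator (-T : E →L[ℂ] E) := hc.neg
    obtain ⟨K, hK, hcard⟩ :=
      exists_finset_posEigenvalue_eq hc' (isSymmetric_neg hs) (neg_pos.2 h)
    rw [ContinuousLinearMap.toLinearMap_neg, eigenspace_neg_neg] at hcard
    refine ⟨K.image fun k : ℕ => -(k : ℤ), Set.ext fun i => ?_, ?_⟩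
    · rw [Finset.mem_coe, Finset.mem_image, eigenvalueIndices, Set.mem_ofPred_eq,
        orderedEigenvalue]
      constructor
      · rintro ⟨k, hk, rfl⟩
        obtain ⟨hk0, hk1⟩ := (hK k).1 hk
        rw [if_neg (by omega), if_pos (by omega), Int.natAbs_neg, Int.natAbs_natCast]
        exact ⟨by omega, by rw [ContinuousLinearMap.toLinearMap_neg] at hk1; rw [hk1, neg_neg]⟩
      · rintro ⟨hi, hiν⟩
        split_ifs at hiν with h1 h2
        · exact absurd (posEigenvalue_nonneg (T : Module.End ℂ E) i.natAbs) (by rw [hiν]; linarith)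
        · refine ⟨i.natAbs, (hK _).2 ⟨by omega, ?_⟩, by omega⟩
          rw [ContinuousLinearMap.toLinearMap_neg]
          linarith
        · omega
    · rw [Finset.card_image_of_injective _ fun a b hab => by simpa using hab, hcard]
  · obtain ⟨K, hK, hcard⟩ := exists_finset_posEigenvalue_eq hc hs h
    refine ⟨K.image fun k : ℕ => (k : ℤ), Set.ext fun i => ?_, ?_⟩
    · rw [Finset.mem_coe, Finset.mem_image, eigenvalueIndices, Set.mem_ofPred_eq,
        orderedEigenvalue]
      constructor
      · rintro ⟨k, hk, rfl⟩
        obtain ⟨hk0, hk1⟩ := (hK k).1 hk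
        rw [if_pos (by omega), Int.natAbs_natCast]
        exact ⟨by omega, hk1⟩
      · rintro ⟨hi, hiν⟩
        split_ifs at hiν with h1 h2
        · exact ⟨i.natAbs, (hK _).2 ⟨by omega, hiν⟩, by omega⟩
        · exact absurd (posEigenvalue_nonneg (-(T : Module.End ℂ E)) i.natAbs) (by linarith)
        · omega
    · rw [Finset.card_image_of_injective _ fun a b hab => by simpa using hab, hcard]

variable {F : Type*} [NormedAddCommGroup F] [InnerProductSpace ℂ F] [CompleteSpace F]

/-- Weyl's perturbation inequality for the ordered eigenvalues of a compression. -/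
theorem abs_orderedEigenvalue_sub_le (hTc : IsCompactOperator T)
    (hTs : (T : Module.End ℂ E).IsSymmetric) {A : F →L[ℂ] F} (hAc : IsCompactOperator A)
    (hAs : (A : Module.End ℂ F).IsSymmetric) (J : F →ₗᵢ[ℂ] E) {T' : E →L[ℂ] E}
    (hT' : ∀ v, T' v = J (A (ContinuousLinearMap.adjoint J.toContinuousLinearMap v)))
    {ε δ : ℝ} (h : ‖T' - T‖ ≤ ε) (hεδ : ε < δ) {i : ℤ}
    (hδ : δ < |orderedEigenvalue (T : Module.End ℂ E) i|) :
    |orderedEigenvalue (A : Module.End ℂ F) i - orderedEigenvalue (T : Module.End ℂ E) i| ≤ δ := by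
  have hδ0 : 0 ≤ δ := (norm_nonneg _).trans (h.trans hεδ.le)
  rw [orderedEigenvalue] at hδ
  rw [orderedEigenvalue, orderedEigenvalue]
  split_ifs at hδ ⊢ with h1 h2
  · rw [abs_of_nonneg (posEigenvalue_nonneg _ _)] at hδ
    exact abs_posEigenvalue_sub_le hTc hTs hAc hAs J hT' h hεδ (by omega) hδ
  · rw [abs_neg, abs_of_nonneg (posEigenvalue_nonneg _ _)] at hδ
    have hTc' : IsCompactOperator (-T : E →L[ℂ] E) := hTc.neg
    have hAc' : IsCompactOperator (-A : F →L[ℂ] F) := hAc.neg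
    have := abs_posEigenvalue_sub_le hTc' (isSymmetric_neg hTs) hAc' (isSymmetric_neg hAs) J
      (T' := -T') (fun v => by rw [neg_apply, hT', neg_apply, map_neg]) (ε := ε)
      (by rwa [← neg_sub', norm_neg]) hεδ (k := i.natAbs) (by omega) hδ
    rw [neg_sub_neg, abs_sub_comm]
    exact this
  -- At index `0` both values are `0` by convention.
  · simpa using hδ0

end Ordered

/-! ### Lifted filters and passage to the limit operator. -/

section Convergence

variable {X : Type*} [MeasurableSpace X] {μ : Measure X} [IsProbabilityMeasure μ]
  (σ : IsoModZero μ)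

/-- The inner product is conjugate-linear in its first argument, so `φ` comes first; the lift
preserves it. -/
theorem graphFourier_eq_inner {N : ℕ} (f φ : EuclideanSpace ℂ (Fin N)) :
    graphFourier f φ = inner ℂ (liftSignal σ φ) (liftSignal σ f) := by
  rw [← liftIsometry_apply, ← liftIsometry_apply, LinearIsometry.inner_map_map,
    PiLp.inner_apply]
  rfl

theorem liftSignal_graphShift_pow {N : ℕ} (G : SimpleGraph (Fin N)) (k : ℕ)
    (v : EuclideanSpace ℂ (Fin N)) :
    liftSignal σ ((graphShift G ^ k) v) = ((graphGraphon σ G).op ^ k) (liftSignal σ v) := by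
  induction k generalizing v with
  | zero => rfl
  | succ k ih =>
    rw [pow_succ, pow_succ, Module.End.mul_apply, ih, ← op_graphGraphon_liftSignal]
    rfl

theorem liftSignal_graphFilter {N : ℕ} (G : SimpleGraph (Fin N)) (h : Polynomial ℂ)
    (v : EuclideanSpace ℂ (Fin N)) :
    liftSignal σ (Matrix.toEuclideanLin (graphFilter G h) v) =
      ∑ k ∈ Finset.range (h.natDegree + 1),
        h.coeff k • ((graphGraphon σ G).op ^ k) (liftSignal σ v) := by
  simp_rw [graphFilter, map_sum, map_smul, Matrix.toLpLin_pow, LinearMap.sum_apply,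
    LinearMap.smul_apply, ← liftIsometry_apply, map_sum, map_smul, liftIsometry_apply,
    ← liftSignal_graphShift_pow]
  rfl

/-- Symmetry survives pointwise limits, so `T_w` inherits it from the graph operators. -/
theorem isSymmetric_of_tendsto {E : Type*} [NormedAddCommGroup E] [InnerProductSpace ℂ E]
    {S : ℕ → E →L[ℂ] E} {T : E →L[ℂ] E} (h : Tendsto S atTop (𝓝 T))
    (hS : ∀ n, (S n : Module.End ℂ E).IsSymmetric) : (T : Module.End ℂ E).IsSymmetric := by
  intro v w
  have h1 : ∀ u, Tendsto (fun n => S n u) atTop (𝓝 (T u)) := fun u =>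
    ((ContinuousLinearMap.apply ℂ E u).continuous.tendsto T).comp h
  refine tendsto_nhds_unique ((h1 v).inner tendsto_const_nhds) ?_
  refine (tendsto_const_nhds.inner (h1 w)).congr fun n => ?_
  exact (hS n v w).symm

theorem starProjection_eigenspace_pow_apply {E : Type*} [NormedAddCommGroup E]
    [InnerProductSpace ℂ E] [CompleteSpace E] {T : E →L[ℂ] E}
    (hTs : (T : Module.End ℂ E).IsSymmetric) (ν : ℝ) (k : ℕ) (v : E) :
    (Module.End.eigenspace (T : Module.End ℂ E) (ν : ℂ)).starProjection ((T ^ k) v) =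
      (ν : ℂ) ^ k • (Module.End.eigenspace (T : Module.End ℂ E) (ν : ℂ)).starProjection v := by
  induction k with
  | zero => simp
  | succ k ih =>
    rw [pow_succ', mul_apply_eq_comp, starProjection_eigenspace_apply hTs, ih,
      smul_smul, pow_succ']

end Convergence

end

/-! ### Convergence of the filtered Fourier components. -/

theorem mainTheorem5 {X : Type*} [MeasurableSpace X] (μ : Measure X) [IsProbabilityMeasure μ]
    (σ : IsoModZero μ)
    -- the limit graphon signal
    (w : Graphon μ) (f : Lp ℂ 2 μ)
    -- labeled graphs and signals on them
    (N : ℕ → ℕ) (G : ∀ n, SimpleGraph (Fin (N n))) (fs : ∀ n, EuclideanSpace ℂ (Fin (N n)))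
    (hconv : ConvergesInNorm (fun n => graphGraphon σ (G n)) (fun n => liftSignal σ (fs n)) w f)
    -- ordered orthonormal eigenvectors of the normalized adjacency matrices
    (φ : ∀ n, ℤ → EuclideanSpace ℂ (Fin (N n)))
    (hφ : ∀ n, IsOrderedEigenvectors (graphShift (G n)) (φ n))
    -- the filter polynomial
    (h : Polynomial ℂ)
    -- a nonzero eigenvalue of the integral operator of the limit
    (ν : ℝ) (hν : ν ≠ 0)
    (heig : Module.End.HasEigenvalue (w.op : Module.End ℂ (Lp ℂ 2 μ)) (ν : ℂ)) :
    (eigenvalueIndices (w.op : Module.End ℂ (Lp ℂ 2 μ)) ν).Finite ∧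
      Tendsto
        (fun n => ∑ᶠ i ∈ eigenvalueIndices (w.op : Module.End ℂ (Lp ℂ 2 μ)) ν,
          graphFourier (Matrix.toEuclideanLin (graphFilter (G n) h) (fs n)) (φ n i) •
            liftSignal σ (φ n i))
        atTop (𝓝 ((h.eval (ν : ℂ)) • w.fourier f ν)) := by
  set Tn : ℕ → Lp ℂ 2 μ →L[ℂ] Lp ℂ 2 μ := fun n => (graphGraphon σ (G n)).op with hTn
  have hT : Tendsto Tn atTop (𝓝 w.op) := Graphon.tendsto_op hconv.1
  have hf : Tendsto (fun n => liftSignal σ (fs n)) atTop (𝓝 f) :=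
    tendsto_iff_norm_sub_tendsto_zero.2 hconv.2
  have hTc : IsCompactOperator w.op := isCompactOperator_of_tendsto hT
    (Eventually.of_forall fun n => isCompactOperator_op_graphGraphon σ (G n))
  have hTs : (w.op : Module.End ℂ (Lp ℂ 2 μ)).IsSymmetric :=
    isSymmetric_of_tendsto hT fun n => isSymmetric_op_graphGraphon σ (G n)
  obtain ⟨I, hI, hcard⟩ := exists_finset_eigenvalueIndices hTc hTs hν
  have hTn0 : Tendsto (fun n => ‖Tn n - w.op‖) atTop (𝓝 0) :=
    tendsto_iff_norm_sub_tendsto_zero.1 hT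
  have hlim : ∀ i ∈ I, Tendsto (fun n => orderedEigenvalue (graphShift (G n)) i) atTop (𝓝 ν) := by
    intro i hi
    obtain ⟨-, hiν⟩ : i ∈ eigenvalueIndices (w.op : Module.End ℂ (Lp ℂ 2 μ)) ν := by
      rwa [← hI, Finset.mem_coe]
    refine Metric.tendsto_nhds.2 fun ε hε => ?_
    -- Weyl's inequality needs `δ` strictly below `|ν|`; the bound `ε / 2` gives the required
    -- accuracy.
    set δ := min (ε / 2) (|ν| / 2)
    have hδ : 0 < δ := lt_min (by linarith) (by linarith [abs_pos.2 hν])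
    filter_upwards [hTn0.eventually_lt_const hδ] with n hn
    have := abs_orderedEigenvalue_sub_le hTc hTs (isCompactOperator_graphShiftL (G n))
      (isSymmetric_graphShift (G n)) (liftIsometry σ (N n)) (op_graphGraphon_apply σ (G n))
      le_rfl hn (i := i)
      (by rw [hiν]; exact (min_le_right _ _).trans_lt (by linarith [abs_pos.2 hν]))
    rw [hiν] at this
    exact this.trans_lt ((min_le_left _ _).trans_lt (by linarith))
  -- Eventually no index of `I` is a padding index, so the `φ n i` really are orthonormal
  -- eigenvectors.
  have hne : ∀ᶠ n in atTop, ∀ i ∈ I, orderedEigenvalue (graphShift (G n)) i ≠ 0 :=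
    (Finset.eventually_all I).2 fun i hi => (hlim i hi).eventually_ne hν
  have hI0 : ∀ i ∈ I, i ≠ 0 := fun i hi => by
    have : i ∈ eigenvalueIndices (w.op : Module.End ℂ (Lp ℂ 2 μ)) ν := by
      rwa [← hI, Finset.mem_coe]
    exact this.1
  refine ⟨hI ▸ I.finite_toSet, ?_⟩
  have ho : ∀ᶠ n in atTop, Orthonormal ℂ fun i : I => liftSignal σ (φ n i) := by
    filter_upwards [hne] with n hn
    have h1 := (hφ n).1.comp
      (fun i : I => (⟨i, hI0 i i.2, hn i i.2⟩ :
        {i : ℤ // i ≠ 0 ∧ orderedEigenvalue (graphShift (G n)) i ≠ 0}))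
      fun a b hab => Subtype.ext (Subtype.mk.inj hab)
    exact h1.comp_linearIsometry (liftIsometry σ (N n))
  have hψ : ∀ i : I, Tendsto (fun n => w.op (liftSignal σ (φ n i)) -
      (ν : ℂ) • liftSignal σ (φ n i)) atTop (𝓝 0) := by
    intro i
    have hb : Tendsto (fun n => ‖Tn n - w.op‖ + |orderedEigenvalue (graphShift (G n)) i - ν|)
        atTop (𝓝 0) := by
      simpa using hTn0.add ((hlim i i.2).sub_const ν).abs
    refine squeeze_zero_norm' ?_ hb
    filter_upwards [ho, hne] with n hn hn0
    set ψ := liftSignal σ (φ n i) with hψdef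
    have hψ1 : ‖ψ‖ = 1 := hn.1 i
    have hTψ : Tn n ψ = ((orderedEigenvalue (graphShift (G n)) i : ℝ) : ℂ) • ψ := by
      rw [hTn, hψdef]
      simp only
      rw [op_graphGraphon_liftSignal, (hφ n).2 i (hI0 i i.2) (hn0 i i.2), ← liftIsometry_apply,
        map_smul, liftIsometry_apply]
    -- The defect splits into the operator error on a unit vector and the eigenvalue error.
    have hdecomp : w.op ψ - (ν : ℂ) • ψ = -((Tn n - w.op) ψ) +
        ((orderedEigenvalue (graphShift (G n)) i - ν : ℝ) : ℂ) • ψ := by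
      rw [sub_apply, hTψ, Complex.ofReal_sub, sub_smul]
      abel
    rw [hdecomp]
    refine (norm_add_le _ _).trans (add_le_add ?_ ?_)
    · rw [norm_neg]
      exact ((Tn n - w.op).le_opNorm ψ).trans_eq (by rw [hψ1, mul_one])
    · rw [norm_smul, hψ1, mul_one, Complex.norm_real, Real.norm_eq_abs]
  have hg : Tendsto (fun n => liftSignal σ (Matrix.toEuclideanLin (graphFilter (G n) h) (fs n)))
      atTop (𝓝 (∑ k ∈ Finset.range (h.natDegree + 1), h.coeff k • (w.op ^ k) f)) := by
    simp only [liftSignal_graphFilter]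
    exact tendsto_finsetSum _ fun k _ => Tendsto.const_smul
      ((isBoundedBilinearMap_apply.continuous.tendsto (w.op ^ k, f)).comp
        ((hT.pow k).prodMk_nhds hf)) _
  have hmain := tendsto_sum_inner_smul hTc hTs hν (by rw [Fintype.card_coe, hcard]) ho hψ hg
  -- The eigenprojection satisfies `P T = ν P`, so `P h(T) = h(ν) P`.
  have hval : (Module.End.eigenspace (w.op : Module.End ℂ (Lp ℂ 2 μ)) (ν : ℂ)).starProjection
      (∑ k ∈ Finset.range (h.natDegree + 1), h.coeff k • (w.op ^ k) f) =
        h.eval (ν : ℂ) • w.fourier f ν := by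
    simp only [map_sum, map_smul, starProjection_eigenspace_pow_apply hTs, smul_smul]
    rw [← Finset.sum_smul, ← Polynomial.eval_eq_sum_range]
    rfl
  rw [hval] at hmain
  refine hmain.congr fun n => ?_
  simp only [← hI, finsum_mem_coe_finset, graphFourier_eq_inner σ]
  exact Finset.sum_coe_sort I fun i => inner ℂ (liftSignal σ (φ n i))
    (liftSignal σ (Matrix.toEuclideanLin (graphFilter (G n) h) (fs n))) • liftSignal σ (φ n i)
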